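/- Work in the plane $\mathbb R^2$. For a non-empty compact convex set $K$ let $w_K(\theta)$ be the distance between the two supporting lines of $K$ orthogonal to $(\cos\theta,\sin\theta)$. $K$ has \emph{minimal width} $w$ if $\min_{\theta\in[0,2\pi]} w_K(\theta)=w$, and \emph{width at least} $w$ if $w_K(\theta)\ge w$ for all $\theta\in[0,2\pi]$. For $r\in[1/3,1/2]$, a \emph{three-$r$-cap} is a set $T_{ABC}=\operatorname{conv}(D_r\cup\{A,B,C\})$, where $D_r$ is a closed disk of radius $r$ and centre $O$, $|OA|=|OB|=|OC|=1-r$, and the three caps $\operatorname{conv}(D_r\cup\{P\})\setminus D_r$, $P\in\{A,B,C\}$, are pairwise disjoint (for $r=1/2$ it is just the disk $D_{1/2}$). For a compact convex set $K$ with non-empty interior let $h(K)=\inf\{\operatorname{Per}(E)/|E| : E\subseteq K \text{ convex},\ |E|>0\}$ be its Cheeger constant, $\lambda_1(K)$ the smallest $\lambda$ for which $-\Delta u=\lambda u$ has a nonzero weak solution $u\in H^1_0(\operatorname{int}K)$, and $T(K)=\int_K|\nabla u|^2$ its torsional rigidity, where $u\in H_0^1(\operatorname{int}K)$ is the weak solution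 of $-\Delta u=1$. (The smallest eigenvalue $\lambda_1(K)$ exists, the torsion problem has a solution, and $T(K)$ does not depend on the choice of the solution.) \textbf{Proposition.} (1) If $K$ is a compact convex set of minimal width $1$, then its inradius $r$ lies in $[1/3,1/2]$, and $K$ contains a three-$r$-cap for this $r$. More generally, every compact convex set $K$ of width at least $1$ contains a three-$r$-cap for some $r\in[1/3,1/2]$. (2) Let $c$ be a constant. If $h\le c$ (respectively $\lambda_1\le c$, respectively $T\ge c$) on all three-$r$-caps, for all $r\in[1/3,1/2]$, then the same bound holds on all compact convex sets of width at least $1$. (3) Let $T_e$ be an equilateral triangle of height $1$. For every $w>0$ the equilateral triangle $wT_e$ has minimal width $w$, and the following hold. (a) If $h(T_{ABC})\le h(T_e)$ for all three-$r$-caps $T_{ABC}$, $r\in[1/3,1/2]$, then for every $w>0$ the triangle $wT_e$ maximizes $h$ among compact convex sets of width at least $w$ (hence also among those of minimal width exactly $w$). (b) If $\lambda_1(T_{ABC})\le\lambda_1(T_e)$ for all three-$r$-caps, then for every $w>0$ the triangle $wT_e$ maximizes $\lambda_1$ among compact convex sets of width at least $w$ (hence also among those of minimal width exactly $w$). (c)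 If $T(T_{ABC})\ge T(T_e)$ for all three-$r$-caps, then for every $w>0$ the triangle $wT_e$ minimizes $T$ among compact convex sets of width at least $w$ (hence also among those of minimal width exactly $w$). -/

import Mathlib

open Set Filter Topology MeasureTheory
open scoped ENNReal ContDiff Pointwise

noncomputable section

/-- The Euclidean plane. -/
abbrev Plane : Type := EuclideanSpace ℝ (Fin 2)

/-! ### Width and inradius -/

/-- The unit vector `(cos θ, sin θ)`. -/
def direction (θ : ℝ) : Plane := !₂[Real.cos θ, Real.sin θ]

/-- The width of `K` in the direction `θ`: the distance between the two supporting lines of `K`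
orthogonal to `(cos θ, sin θ)`. -/
def width (K : Set Plane) (θ : ℝ) : ℝ :=
  sSup ((fun x : Plane => inner ℝ x (direction θ)) '' K) -
    sInf ((fun x : Plane => inner ℝ x (direction θ)) '' K)

/-- Compact convex sets whose width is at least `w` in every direction
(the minimal width constraint as an inequality). -/
def shapesOfWidthAtLeast (w : ℝ) : Set (Set Plane) :=
  {K | Convex ℝ K ∧ IsCompact K ∧ K.Nonempty ∧ ∀ θ ∈ Icc 0 (2 * Real.pi), w ≤ width K θ}

/-- Compact convex sets for which the minimum of the width function is equal to `w`. -/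
def shapesOfMinimalWidth (w : ℝ) : Set (Set Plane) :=
  {K | Convex ℝ K ∧ IsCompact K ∧ K.Nonempty ∧ IsLeast (width K '' Icc 0 (2 * Real.pi)) w}

/-- The inradius: the largest radius of a closed disk contained in `K`. -/
def inradius (K : Set Plane) : ℝ :=
  sSup {r : ℝ | 0 ≤ r ∧ ∃ O : Plane, Metric.closedBall O r ⊆ K}

/-! ### Equilateral triangles and three-`r`-caps -/

/-- `S` is a (full, closed) equilateral triangle of height `w`, i.e. of side `s` with
`w = (√3 / 2) s`. -/
def IsEquilateralTriangle (w : ℝ) (S : Set Plane) : Prop :=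
  ∃ (A B C : Plane) (s : ℝ), 0 < s ∧ w = Real.sqrt 3 / 2 * s ∧
    dist A B = s ∧ dist B C = s ∧ dist C A = s ∧ S = convexHull ℝ {A, B, C}

/-- The cap of the point `A` over the disk of centre `O` and radius `r`: the region bounded by the
disk and by the two tangents from `A` to it. It is empty when `A` lies on the disk. -/
def cap (O : Plane) (r : ℝ) (A : Plane) : Set Plane :=
  convexHull ℝ (insert A (Metric.closedBall O r)) \ Metric.closedBall O r

/-- `T` is a three-`r`-cap, `r ∈ [1/3, 1/2]`: the convex hull of a disk of radius `r` and centre `O`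
and of three points at distance `1 - r` from `O`, whose caps are pairwise disjoint. (Caps do not
include points of the closed disk, so two adjacent caps may share a point of tangency.)
For `r = 1/2` this is a disk of radius `1/2`. -/
def IsThreeCap (r : ℝ) (T : Set Plane) : Prop :=
  r ∈ Icc (1 / 3 : ℝ) (1 / 2) ∧
  ∃ O A B C : Plane,
    dist A O = 1 - r ∧ dist B O = 1 - r ∧ dist C O = 1 - r ∧
    Disjoint (cap O r A) (cap O r B) ∧ Disjoint (cap O r B) (cap O r C) ∧
    Disjoint (cap O r C) (cap O r A) ∧
    T = convexHull ℝ (Metric.closedBall O r ∪ {A, B, C})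

/-! ### The Cheeger constant -/

/-- The perimeter of a planar convex set: the length (one-dimensional Hausdorff measure) of its
boundary. -/
def perimeter (E : Set Plane) : ℝ≥0∞ := Measure.hausdorffMeasure 1 (frontier E)

/-- The Cheeger constant: the infimum of `Per(E) / |E|` over convex `E ⊆ K` of positive area. -/
def cheeger (K : Set Plane) : ℝ≥0∞ :=
  ⨅ (E : Set Plane) (_ : Convex ℝ E ∧ E ⊆ K ∧ 0 < volume E), perimeter E / volume E

/-! ### The space `H¹₀`, the first Dirichlet eigenvalue and the torsional rigidity -/

/-- Test functions: smooth functions with compact support in the interior of `Ω`. -/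
def IsTestFunction (Ω : Set Plane) (φ : Plane → ℝ) : Prop :=
  ContDiff ℝ ∞ φ ∧ HasCompactSupport φ ∧ tsupport φ ⊆ interior Ω

/-- `u` (extended by zero) belongs to `H¹₀` of the interior of `Ω`, the closure of the test
functions in the `H¹` norm, and `g` is its weak gradient. -/
def IsH10 (Ω : Set Plane) (u : Plane → ℝ) (g : Plane → Plane) : Prop :=
  MemLp u 2 volume ∧ MemLp g 2 volume ∧
  ∃ φ : ℕ → Plane → ℝ, (∀ n, IsTestFunction Ω (φ n)) ∧
    Tendsto (fun n => eLpNorm (fun x => φ n x - u x) 2 volume) atTop (𝓝 0) ∧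
    Tendsto (fun n => eLpNorm (fun x => gradient (φ n) x - g x) 2 volume) atTop (𝓝 0)

/-- `μ` is a Dirichlet eigenvalue of the Laplacian on `Ω`: there is a nonzero `u ∈ H¹₀` with
`-Δ u = μ u` in the weak sense. -/
def IsDirichletEigenvalue (Ω : Set Plane) (μ : ℝ) : Prop :=
  ∃ (u : Plane → ℝ) (g : Plane → Plane), IsH10 Ω u g ∧ ¬ (u =ᵐ[volume] 0) ∧
    ∀ φ : Plane → ℝ, IsTestFunction Ω φ →
      ∫ x, inner ℝ (g x) (gradient φ x) = μ * ∫ x, u x * φ x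

/-- The first (smallest) Dirichlet eigenvalue. -/
def firstEigenvalue (Ω : Set Plane) : ℝ := sInf {μ : ℝ | IsDirichletEigenvalue Ω μ}

/-- `u`, with weak gradient `g`, is the torsion function of `Ω`: the weak solution in `H¹₀` of
`-Δ u = 1`. -/
def IsTorsionFunction (Ω : Set Plane) (u : Plane → ℝ) (g : Plane → Plane) : Prop :=
  IsH10 Ω u g ∧ ∀ φ : Plane → ℝ, IsTestFunction Ω φ →
    ∫ x, inner ℝ (g x) (gradient φ x) = ∫ x, φ x

/-- The torsional rigidity `∫_Ω |∇u|²`, where `u` is the torsion function of `Ω`. The supremum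
only serves to pick the value, which is the same for all representatives of `u` and `∇u`. -/
def torsionalRigidity (Ω : Set Plane) : ℝ :=
  sSup {t : ℝ | ∃ (u : Plane → ℝ) (g : Plane → Plane),
    IsTorsionFunction Ω u g ∧ t = ∫ x in Ω, ‖g x‖ ^ 2}

end

noncomputable section

/-! ### Directions and widths -/

/-! Geometry. Let `r` be the inradius and `O` an incentre. Zero lies in the convex hull of the unit
normals of the supporting lines touching the incircle (`zero_mem_convexHull_contactNormals`), since
otherwise the disk could be moved and enlarged. Carathéodory gives three such normals `n i` with
weights `w i`. If `r ≥ 1/2`, a disk of radius 1/2 is already a three-cap. If `r < 1/2`, opposite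
contact normals would confine `K` to a strip of width `2r < 1`, so no two are opposite and all
weights are positive. Width at least 1 provides `P i ∈ K` with `⟨n i, P i - O⟩ ≤ -(1 - r)`; pulling
`P i` towards `O` gives the tips of the caps. Pairing `∑ w i • n i = 0` with `P i - O` gives `w i ≤
r`, and summing gives `r ≥ 1/3`. Seen from `O`, the cap of the `i`-th tip lies strictly inside the
cone of the other two normals, so the caps are disjoint (`exists_isThreeCap_of_inradius_lt_half`).

Analysis. All three functionals are monotone under inclusion, so a bound on three-caps passes to
every set containing one. For the Cheeger constant this is immediate. For the other two it follows
from variational principles over test functions (`le_firstEigenvalue_iff`,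
`torsionalRigidity_le_iff`). The first eigenvalue comes from maximizing the norm of the embedding of
`H¹₀` into `L²`, which is compact by Poincaré inequalities on the cells of a fine grid; the torsion
function comes from Lax–Milgram.

The statements for width `w` reduce to width 1 by homogeneity of degrees -1, -2 and 4, and the
triangle is admissible by `IsEquilateralTriangle.mem_shapesOfMinimalWidth`. -/

lemma norm_direction (θ : ℝ) : ‖direction θ‖ = 1 := by
  simp [direction, EuclideanSpace.norm_eq]

lemma exists_direction_eq {n : Plane} (hn : ‖n‖ = 1) :
    ∃ θ ∈ Icc 0 (2 * Real.pi), direction θ = n := by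
  have h : n 0 ^ 2 + n 1 ^ 2 = 1 := by
    have := EuclideanSpace.norm_sq_eq n
    simpa [hn, Fin.sum_univ_two] using this.symm
  have hz : ‖(⟨n 0, n 1⟩ : ℂ)‖ = 1 := by
    rw [Complex.norm_def, Complex.normSq_mk, ← pow_two, ← pow_two, h, Real.sqrt_one]
  set z : ℂ := ⟨n 0, n 1⟩ with hzdef
  have hz0 : z ≠ 0 := by rintro h0; simp [h0] at hz
  have hc : Real.cos z.arg = n 0 := by rw [Complex.cos_arg hz0, hz]; simp [hzdef]
  have hs : Real.sin z.arg = n 1 := by rw [Complex.sin_arg, hz]; simp [hzdef]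
  have hpi := Real.pi_pos
  by_cases harg : 0 ≤ z.arg
  · refine ⟨z.arg, ⟨harg, by linarith [Complex.arg_le_pi z]⟩, ?_⟩
    ext i; fin_cases i <;> simp [direction, hc, hs]
  · refine ⟨z.arg + 2 * Real.pi, ⟨by linarith [Complex.neg_pi_lt_arg z], by linarith⟩, ?_⟩
    ext i; fin_cases i <;> simp [direction, hc, hs]

lemma inner_sub_le_width {K : Set Plane} (hK : IsCompact K) {x y : Plane} (hx : x ∈ K) (hy : y ∈ K)
    (θ : ℝ) : inner ℝ (x - y) (direction θ) ≤ width K θ := by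
  have hc := hK.image (f := fun x : Plane => inner ℝ x (direction θ)) (by fun_prop)
  rw [inner_sub_left]
  exact sub_le_sub (le_csSup hc.bddAbove ⟨x, hx, rfl⟩) (csInf_le hc.bddBelow ⟨y, hy, rfl⟩)

lemma exists_inner_sub_eq_width {K : Set Plane} (hK : IsCompact K) (hne : K.Nonempty) (θ : ℝ) :
    ∃ x ∈ K, ∃ y ∈ K, inner ℝ (x - y) (direction θ) = width K θ := by
  have hc := hK.image (f := fun x : Plane => inner ℝ x (direction θ)) (by fun_prop)
  obtain ⟨x, hx, hx'⟩ := hc.sSup_mem (hne.image _)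
  obtain ⟨y, hy, hy'⟩ := hc.sInf_mem (hne.image _)
  refine ⟨x, hx, y, hy, ?_⟩
  rw [inner_sub_left, width, ← hx', ← hy']

lemma exists_le_inner_sub_of_width {w : ℝ} {K : Set Plane} (hK : K ∈ shapesOfWidthAtLeast w)
    {n : Plane} (hn : ‖n‖ = 1) : ∃ x ∈ K, ∃ y ∈ K, w ≤ inner ℝ (x - y) n := by
  obtain ⟨-, hc, hne, hw⟩ := hK
  obtain ⟨θ, hθ, rfl⟩ := exists_direction_eq hn
  obtain ⟨x, hx, y, hy, h⟩ := exists_inner_sub_eq_width hc hne θ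
  exact ⟨x, hx, y, hy, h ▸ hw θ hθ⟩

lemma shapesOfMinimalWidth_subset (w : ℝ) : shapesOfMinimalWidth w ⊆ shapesOfWidthAtLeast w :=
  fun _ ⟨h1, h2, h3, h4⟩ => ⟨h1, h2, h3, fun θ hθ => h4.2 ⟨θ, hθ, rfl⟩⟩

/-! ### Inscribed disks -/

/-- A point of the disk outside `K` would be strictly separated from `K`, and the hypothesis fails
for the normalized separating direction. Containment of a disk thus becomes a condition on the
support function. -/
lemma closedBall_subset_of_forall_inner {K : Set Plane} (hconv : Convex ℝ K) (hcl : IsClosed K)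
    {O : Plane} {r : ℝ} (h : ∀ n : Plane, ‖n‖ = 1 → ∃ x ∈ K, r ≤ inner ℝ n (x - O)) :
    Metric.closedBall O r ⊆ K := by
  intro p hp
  by_contra hpK
  obtain ⟨f, u, hf, hu⟩ := geometric_hahn_banach_closed_point hconv hcl hpK
  set v := (InnerProductSpace.toDual ℝ Plane).symm f with hv
  have hfv : ∀ x, f x = inner ℝ v x := fun x => by simp [hv]
  have hv0 : v ≠ 0 := by
    intro h0
    obtain ⟨x, hx, -⟩ := h (direction 0) (norm_direction 0)
    have := hf x hx
    simp only [hfv, h0, inner_zero_left] at this hu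
    linarith
  have hvn : 0 < ‖v‖ := norm_pos_iff.2 hv0
  obtain ⟨x, hx, hxr⟩ := h (‖v‖⁻¹ • v) (by rw [norm_smul, norm_inv, norm_norm]; field_simp)
  rw [inner_smul_left] at hxr
  simp only [conj_trivial] at hxr
  have h1 : ‖v‖ * r ≤ inner ℝ v (x - O) := by
    have := mul_le_mul_of_nonneg_left hxr hvn.le
    rwa [← mul_assoc, mul_inv_cancel₀ hvn.ne', one_mul] at this
  have h2 : inner ℝ v (p - O) ≤ ‖v‖ * r :=
    (real_inner_le_norm _ _).trans (mul_le_mul_of_nonneg_left (mem_closedBall_iff_norm.1 hp) hvn.le)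
  have h3 := hf x hx
  rw [hfv] at h3 hu
  rw [inner_sub_right] at h1 h2
  linarith

lemma exists_inner_ge_of_closedBall_subset {K : Set Plane} {O : Plane} {r : ℝ} (hr : 0 ≤ r)
    (h : Metric.closedBall O r ⊆ K) {n : Plane} (hn : ‖n‖ = 1) :
    ∃ x ∈ K, r ≤ inner ℝ n (x - O) := by
  refine ⟨O + r • n, h ?_, ?_⟩
  · simp [norm_smul, hn, abs_of_nonneg hr]
  · simp [inner_smul_right, hn]

lemma two_mul_le_width {K : Set Plane} (hK : IsCompact K) {O : Plane} {r : ℝ} (hr : 0 ≤ r)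
    (h : Metric.closedBall O r ⊆ K) (θ : ℝ) : 2 * r ≤ width K θ := by
  have h1 : O + r • direction θ ∈ K := h (by simp [norm_smul, norm_direction, abs_of_nonneg hr])
  have h2 : O - r • direction θ ∈ K := h (by simp [norm_smul, norm_direction, abs_of_nonneg hr])
  have := inner_sub_le_width hK h1 h2 θ
  have e : O + r • direction θ - (O - r • direction θ) = (2 * r) • direction θ := by module
  rw [e, inner_smul_left, real_inner_self_eq_norm_sq, norm_direction] at this
  simpa using this

lemma bddAbove_inradius {K : Set Plane} (hK : IsCompact K) :
    BddAbove {r : ℝ | 0 ≤ r ∧ ∃ O : Plane, Metric.closedBall O r ⊆ K} :=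
  ⟨width K 0 / 2, fun r ⟨hr, O, hO⟩ => by linarith [two_mul_le_width hK hr hO 0]⟩

lemma le_inradius {K : Set Plane} (hK : IsCompact K) {O : Plane} {r : ℝ} (hr : 0 ≤ r)
    (h : Metric.closedBall O r ⊆ K) : r ≤ inradius K :=
  le_csSup (bddAbove_inradius hK) ⟨hr, O, h⟩

lemma inradius_nonneg (K : Set Plane) : 0 ≤ inradius K :=
  Real.sSup_nonneg fun _ h => h.1

/-- The distance to the complement is continuous, so it attains a maximum on `K`; it bounds the
radius of any disk in `K` by its value at the centre. -/
lemma exists_closedBall_inradius_subset {K : Set Plane} (hK : IsCompact K) (hne : K.Nonempty) :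
    ∃ O, Metric.closedBall O (inradius K) ⊆ K := by
  obtain ⟨O, hO, hmax⟩ := hK.exists_isMaxOn hne
    (Metric.continuous_infDist_pt Kᶜ).continuousOn
  have hsub : Metric.closedBall O (Metric.infDist O Kᶜ) ⊆ K := by
    have := Metric.closedBall_infDist_compl_subset_closure hO
    rwa [hK.isClosed.closure_eq] at this
  -- Needed because `Metric.infDist` to the empty set is 0 by convention.
  have hcompl : (Kᶜ).Nonempty := by
    rw [nonempty_compl]; rintro rfl
    exact noncompact_univ Plane hK
  refine ⟨O, (Metric.closedBall_subset_closedBall ?_).trans hsub⟩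
  refine csSup_le ⟨0, le_rfl, O, by simpa using hO⟩ ?_
  rintro r ⟨hr, P, hP⟩
  have hPK : P ∈ K := hP (Metric.mem_closedBall_self hr)
  refine le_trans ?_ (hmax hPK)
  refine (Metric.le_infDist hcompl).2 fun y hy => ?_
  by_contra! hlt
  exact hy (hP (by rw [Metric.mem_closedBall, dist_comm]; exact hlt.le))

/-- The outer unit normals of the supporting lines of `K` at distance at most `r` from `O`. -/
def contactNormals (K : Set Plane) (O : Plane) (r : ℝ) : Set Plane :=
  {n | ‖n‖ = 1 ∧ ∀ x ∈ K, inner ℝ n (x - O) ≤ r}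

lemma isCompact_contactNormals (K : Set Plane) (O : Plane) (r : ℝ) :
    IsCompact (contactNormals K O r) := by
  refine (isCompact_sphere (0 : Plane) 1).of_isClosed_subset ?_ fun n hn => by simpa using hn.1
  have : contactNormals K O r = {n | ‖n‖ = 1} ∩ ⋂ x ∈ K, {n | inner ℝ n (x - O) ≤ r} := by
    ext n; simp [contactNormals]
  rw [this]
  exact (isClosed_eq continuous_norm continuous_const).inter
    (isClosed_biInter fun x _ => isClosed_le (by fun_prop) continuous_const)

/-- Carathéodory's theorem in the plane, with three points. -/
lemma exists_fin_three_of_mem_convexHull {s : Set Plane} {x : Plane} (hx : x ∈ convexHull ℝ s) :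
    ∃ (n : Fin 3 → Plane) (w : Fin 3 → ℝ), (∀ i, n i ∈ s) ∧ w ∈ stdSimplex ℝ (Fin 3) ∧
      ∑ i, w i • n i = x := by
  obtain ⟨p, hp⟩ := convexHull_nonempty_iff.1 ⟨x, hx⟩
  obtain ⟨ι, _, z, w, hz, hind, hw, hw1, hwx⟩ := eq_pos_convex_span_of_mem_convexHull hx
  have hcard : Fintype.card ι ≤ Fintype.card (Fin 3) := by
    refine hind.card_le_finrank_succ.trans ?_
    have := Submodule.finrank_le (vectorSpan ℝ (Set.range z))
    simp at this ⊢
    omega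
  obtain ⟨e⟩ := Function.Embedding.nonempty_of_card_le hcard
  have hsum : ∀ {M : Type} [AddCommMonoid M] (f : Fin 3 → M), (∀ j ∉ Set.range e, f j = 0) →
      ∑ j, f j = ∑ i, f (e i) := fun f hf => by
    rw [← Finset.sum_map Finset.univ e f]
    refine (Finset.sum_subset (Finset.subset_univ _) fun j _ hj => hf j ?_).symm
    simpa using hj
  have hext : ∀ j ∉ Set.range e, Function.extend e w 0 j = 0 := fun j hj => by
    rw [Function.extend_apply' _ _ _ hj]; rfl
  -- Affine independence leaves at most three points; the list is padded with `p` at weight 0.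
  refine ⟨Function.extend e z fun _ => p, Function.extend e w 0, fun j => ?_, ⟨fun j => ?_, ?_⟩, ?_⟩
  · by_cases hj : ∃ i, e i = j
    · obtain ⟨i, rfl⟩ := hj
      rw [e.injective.extend_apply]; exact hz ⟨i, rfl⟩
    · rwa [Function.extend_apply' _ _ _ hj]
  · by_cases hj : ∃ i, e i = j
    · obtain ⟨i, rfl⟩ := hj
      rw [e.injective.extend_apply]; exact (hw i).le
    · rw [Function.extend_apply' _ _ _ hj]; rfl
  · rw [hsum _ hext, ← hw1]
    simp [e.injective.extend_apply]
  · rw [hsum _ fun j hj => by rw [hext j hj, zero_smul], ← hwx]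
    simp [e.injective.extend_apply]

/-- By Carathéodory the hull is a continuous image of `s³` times a simplex. -/
lemma isCompact_convexHull_plane {s : Set Plane} (hs : IsCompact s) :
    IsCompact (convexHull ℝ s) := by
  have h : IsCompact ((fun p : (Fin 3 → Plane) × (Fin 3 → ℝ) => ∑ i, p.2 i • p.1 i) ''
      ((Set.pi univ fun _ => s) ×ˢ stdSimplex ℝ (Fin 3))) :=
    ((isCompact_univ_pi fun _ => hs).prod (isCompact_stdSimplex ℝ _)).image (by fun_prop)
  convert h using 1
  refine Subset.antisymm (fun x hx => ?_) ?_
  · obtain ⟨n, w, hn, hw, hx⟩ := exists_fin_three_of_mem_convexHull hx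
    exact ⟨(n, w), ⟨fun i _ => hn i, hw⟩, hx⟩
  · rintro _ ⟨⟨n, w⟩, ⟨hn, hw⟩, rfl⟩
    exact (convex_convexHull ℝ s).sum_mem (fun i _ => hw.1 i) hw.2
      fun i _ => subset_convexHull ℝ s (hn i (mem_univ i))

/-- Otherwise some `v` satisfies `⟨v, n⟩ > u > 0` for all contact normals `n`, and moving the centre
by `-ε v` loosens every contact. A larger disk fits unless some direction obstructs it for each
small `ε`; a limit of such directions is a contact normal with `⟨v, n⟩ ≤ u / 2`. -/
lemma zero_mem_convexHull_contactNormals {K : Set Plane} (hconv : Convex ℝ K) (hK : IsCompact K)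
    {O : Plane} (hO : Metric.closedBall O (inradius K) ⊆ K) :
    (0 : Plane) ∈ convexHull ℝ (contactNormals K O (inradius K)) := by
  set r := inradius K with hr
  have hr0 : 0 ≤ r := inradius_nonneg K
  by_contra h0
  have hcN := isCompact_contactNormals K O r
  obtain ⟨f, u, hf0, hu⟩ := geometric_hahn_banach_point_closed (convex_convexHull ℝ _)
    (isCompact_convexHull_plane hcN).isClosed h0
  set v := (InnerProductSpace.toDual ℝ Plane).symm f with hv
  have hfv : ∀ x, f x = inner ℝ v x := fun x => by simp [hv]
  rw [map_zero] at hf0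
  have hN : ∀ n ∈ contactNormals K O r, u < inner ℝ v n := fun n hn => by
    rw [← hfv]; exact hu n (subset_convexHull ℝ _ hn)
  -- The left side is the support function about the shifted centre `O - ε • v`, with `ε = 1 / (k +
  -- 1)`; the right side is a radius exceeding `r`, which cannot fit.
  have key : ∀ k : ℕ, ∃ n : Plane, ‖n‖ = 1 ∧ ∀ x ∈ K,
      inner ℝ n (x - O) + (1 / ((k : ℝ) + 1)) * inner ℝ v n < r + (1 / ((k : ℝ) + 1)) * (u / 2) := by
    intro k
    set ε := 1 / ((k : ℝ) + 1)
    have hε : 0 < ε := by positivity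
    by_contra! hcon
    have hsub : Metric.closedBall (O - ε • v) (r + ε * (u / 2)) ⊆ K := by
      refine closedBall_subset_of_forall_inner hconv hK.isClosed fun n hn => ?_
      obtain ⟨x, hx, hx'⟩ := hcon n hn
      refine ⟨x, hx, hx'.trans_eq ?_⟩
      rw [show x - (O - ε • v) = (x - O) + ε • v by abel, inner_add_right, inner_smul_right,
        real_inner_comm v n]
    have := le_inradius hK (by positivity) hsub
    rw [← hr] at this
    nlinarith
  choose n hn1 hnK using key
  obtain ⟨m, hm, φ, hφ, hlim⟩ := (isCompact_sphere (0 : Plane) 1).tendsto_subseq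
    (x := n) (fun k => by simp [hn1 k])
  have hε0 : Tendsto (fun k => 1 / (((φ k : ℕ) : ℝ) + 1)) atTop (𝓝 0) :=
    tendsto_one_div_add_atTop_nhds_zero_nat.comp hφ.tendsto_atTop
  have hmN : m ∈ contactNormals K O r := by
    refine ⟨by simpa using hm, fun x hx => ?_⟩
    have l1 : Tendsto (fun k => inner ℝ (n (φ k)) (x - O) +
        (1 / (((φ k : ℕ) : ℝ) + 1)) * inner ℝ v (n (φ k))) atTop
        (𝓝 (inner ℝ m (x - O) + 0 * inner ℝ v m)) :=
      (hlim.inner tendsto_const_nhds).add (hε0.mul (tendsto_const_nhds.inner hlim))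
    have l2 : Tendsto (fun k => r + (1 / (((φ k : ℕ) : ℝ) + 1)) * (u / 2)) atTop
        (𝓝 (r + 0 * (u / 2))) := tendsto_const_nhds.add (hε0.mul tendsto_const_nhds)
    have := le_of_tendsto_of_tendsto' l1 l2 fun k => (hnK (φ k) x hx).le
    simpa using this
  have hle : inner ℝ v m ≤ u / 2 := by
    refine le_of_tendsto' (tendsto_const_nhds.inner hlim) fun k => ?_
    -- The incircle makes the support function about `O` at least `r`, so `r` cancels from the
    -- obstruction and only the terms in `ε` remain.
    obtain ⟨x, hx, hx'⟩ := exists_inner_ge_of_closedBall_subset hr0 hO (hn1 (φ k))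
    have h1 := hnK (φ k) x hx
    have hε : 0 < 1 / (((φ k : ℕ) : ℝ) + 1) := by positivity
    have : (1 / (((φ k : ℕ) : ℝ) + 1)) * inner ℝ v (n (φ k)) ≤
        (1 / (((φ k : ℕ) : ℝ) + 1)) * (u / 2) := by linarith
    exact le_of_mul_le_mul_left this hε
  have := hN m hmN
  linarith

/-! ### Three-caps inside sets of width at least one -/

/-- Otherwise the half-plane `⟨u, y - O⟩ ≤ r` would contain the disk and `A`, hence their hull, but
not `x`. -/
lemma inner_gt_of_mem_cap {O A x : Plane} {r : ℝ} (hr : 0 ≤ r) (hx : x ∈ cap O r A) :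
    ∃ u : Plane, ‖u‖ = 1 ∧ u = ‖x - O‖⁻¹ • (x - O) ∧ r < inner ℝ u (A - O) := by
  obtain ⟨hx1, hx2⟩ := hx
  rw [mem_closedBall_iff_norm, not_le] at hx2
  have hpos : 0 < ‖x - O‖ := hr.trans_lt hx2
  have hu : ‖‖x - O‖⁻¹ • (x - O)‖ = 1 := by rw [norm_smul, norm_inv, norm_norm]; field_simp
  refine ⟨_, hu, rfl, ?_⟩
  set u := ‖x - O‖⁻¹ • (x - O) with hudef
  by_contra! hA
  have hsub : convexHull ℝ (insert A (Metric.closedBall O r)) ⊆ {y | inner ℝ u y ≤ r + inner ℝ u O} := by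
    refine convexHull_min ?_ (convex_halfSpace_le (innerₗ Plane u).isLinear _)
    rintro y (rfl | hy)
    · rw [inner_sub_right] at hA
      simp only [mem_ofPred_eq]; linarith
    · have := real_inner_le_norm u (y - O)
      rw [hu, one_mul, inner_sub_right] at this
      have := mem_closedBall_iff_norm.1 hy
      simp only [mem_ofPred_eq]; linarith
  have h1 : inner ℝ u x ≤ r + inner ℝ u O := hsub hx1
  have h2 : inner ℝ u (x - O) = ‖x - O‖ := by
    rw [hudef, inner_smul_left, real_inner_self_eq_norm_sq, conj_trivial]; field_simp
  rw [inner_sub_right] at h2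
  linarith

lemma cap_eq_empty {O A : Plane} {r : ℝ} (hA : A ∈ Metric.closedBall O r) : cap O r A = ∅ := by
  rw [cap, insert_eq_of_mem hA, (convex_closedBall O r).convexHull_eq, sdiff_self]

/-- The tips lie on the circle and all caps are empty, so the three tips may coincide. -/
lemma isThreeCap_closedBall (O : Plane) : IsThreeCap (1 / 2) (Metric.closedBall O (1 / 2)) := by
  have hd : dist (O + (1 / 2 : ℝ) • direction 0) O = 1 - 1 / 2 := by
    rw [dist_self_add_left, norm_smul, norm_direction]; norm_num
  have hA : O + (1 / 2 : ℝ) • direction 0 ∈ Metric.closedBall O (1 / 2) := by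
    rw [Metric.mem_closedBall, hd]; norm_num
  refine ⟨by norm_num, O, _, _, _, hd, hd, hd, ?_, ?_, ?_, ?_⟩
  · rw [cap_eq_empty hA]; exact disjoint_empty _
  · rw [cap_eq_empty hA]; exact disjoint_empty _
  · rw [cap_eq_empty hA]; exact disjoint_empty _
  · rw [pair_eq_singleton, pair_eq_singleton, union_eq_self_of_subset_right (by simpa using hA),
      (convex_closedBall O _).convexHull_eq]

/-- The triangle inequality gives `b ≤ 1 + a`, so the inner product is at most `(b - a) r ≤ r`. This
excludes from the `i`-th cap every direction in a cone having `n i` as a generator. -/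
lemma inner_le_of_mem_cone {u m n P : Plane} {a b r : ℝ} (hu : ‖u‖ = 1) (hm : ‖m‖ = 1)
    (hn : ‖n‖ = 1) (ha : 0 ≤ a) (hb : 0 ≤ b) (hr : 0 ≤ r) (h : u = a • m + b • n)
    (hmP : inner ℝ m P ≤ -r) (hnP : inner ℝ n P ≤ r) : inner ℝ u P ≤ r := by
  have hba : b ≤ 1 + a := by
    have e : b • n = u - a • m := by rw [h]; abel
    have := norm_sub_le u (a • m)
    rw [← e, norm_smul, norm_smul, hu, hm, hn, Real.norm_of_nonneg ha, Real.norm_of_nonneg hb] at this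
    linarith
  rw [h, inner_add_left, inner_smul_left, inner_smul_left]
  simp only [conj_trivial]
  nlinarith

/-- Three unit vectors, no two of them opposite, with the origin in their convex hull: the cones
spanned by two of them cover the plane. -/
lemma exists_cone_of_not_antipodal {n : Fin 3 → Plane} {w : Fin 3 → ℝ} (hn : ∀ i, ‖n i‖ = 1)
    (hw : ∀ i, 0 < w i) (h0 : ∑ i, w i • n i = 0) (hanti : ∀ i j, n i ≠ -n j) (u : Plane) :
    ∃ c : Fin 3 → ℝ, (∀ i, 0 ≤ c i) ∧ (∃ k, c k = 0) ∧ u = ∑ i, c i • n i := by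
  -- Parallel unit vectors are opposite or equal; if equal, the relation forces the third one to be
  -- opposite to them.
  have hli : LinearIndependent ℝ ![n 0, n 1] := by
    rw [LinearIndependent.pair_iff' (by intro h; simpa [h] using hn 0)]
    intro a ha
    have habs : |a| = 1 := by
      have := hn 1
      rwa [← ha, norm_smul, hn 0, mul_one] at this
    rcases abs_eq (zero_le_one (α := ℝ)) |>.1 habs with rfl | rfl
    · rw [one_smul] at ha
      have e : w 2 • n 2 = -((w 0 + w 1) • n 0) := by
        rw [Fin.sum_univ_three, ← ha] at h0
        rw [eq_neg_iff_add_eq_zero, ← h0]; module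
      have hwe : w 2 = w 0 + w 1 := by
        have := congrArg norm e
        rwa [norm_neg, norm_smul, norm_smul, hn, hn, Real.norm_of_nonneg (hw 2).le,
          Real.norm_of_nonneg (add_pos (hw 0) (hw 1)).le, mul_one, mul_one] at this
      rw [← hwe, ← smul_neg] at e
      exact hanti 2 0 (smul_right_injective _ (hw 2).ne' e)
    · exact hanti 1 0 (by rw [← ha]; simp)
  have hspan := hli.span_eq_top_of_card_eq_finrank (by simp)
  have hu : u ∈ Submodule.span ℝ (Set.range ![n 0, n 1]) := hspan ▸ Submodule.mem_top
  rw [Matrix.range_cons, Matrix.range_cons, Matrix.range_empty, union_empty,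
    singleton_union, Submodule.mem_span_pair] at hu
  obtain ⟨a, b, hab⟩ := hu
  set c : Fin 3 → ℝ := ![a, b, 0] with hc
  have hcu : u = ∑ i, c i • n i := by simp [Fin.sum_univ_three, hc, hab]
  -- Subtracting the minimal ratio times the relation `∑ w i • n i = 0` keeps the vector, makes all
  -- coefficients nonnegative and kills the `k`-th.
  obtain ⟨k, -, hk⟩ := Finset.exists_min_image Finset.univ (fun i => c i / w i) ⟨0, Finset.mem_univ 0⟩
  refine ⟨fun i => c i - c k / w k * w i, fun i => ?_, ⟨k, ?_⟩, ?_⟩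
  · have := (le_div_iff₀ (hw i)).1 (hk i (Finset.mem_univ i))
    linarith
  · have := (hw k).ne'
    field_simp; ring
  · simp only [sub_smul, mul_smul, Finset.sum_sub_distrib, ← Finset.smul_sum, h0, smul_zero,
      sub_zero]
    exact hcu

lemma exists_isThreeCap_of_inradius_lt_half {K : Set Plane} (hK : K ∈ shapesOfWidthAtLeast 1)
    (hlt : inradius K < 1 / 2) :
    1 / 3 ≤ inradius K ∧ ∃ T : Set Plane, IsThreeCap (inradius K) T ∧ T ⊆ K := by
  obtain ⟨hconv, hc, hne, -⟩ := id hK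
  obtain ⟨O, hO⟩ := exists_closedBall_inradius_subset hc hne
  obtain ⟨n, w, hn, ⟨hw0, hw1⟩, h0⟩ :=
    exists_fin_three_of_mem_convexHull (zero_mem_convexHull_contactNormals hconv hc hO)
  have hr0 := inradius_nonneg K
  set r := inradius K with hr
  have hnn : ∀ i, ‖n i‖ = 1 := fun i => (hn i).1
  have hanti : ∀ i j, n i ≠ -n j := fun i j hij => by
    obtain ⟨x, hx, y, hy, hxy⟩ := exists_le_inner_sub_of_width hK (hnn i)
    have h1 := (hn i).2 x hx
    have h2 := (hn j).2 y hy
    rw [show n j = -n i by rw [hij, neg_neg], inner_neg_left] at h2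
    rw [real_inner_comm, show x - y = (x - O) - (y - O) by abel, inner_sub_right] at hxy
    linarith
  -- If one weight vanished, the other two normals would be opposite.
  have key : ∀ i j k : Fin 3, w i • n i + w j • n j + w k • n k = 0 → w i + w j + w k = 1 →
      0 < w i := fun i j k hs hsum => by
    refine (hw0 i).lt_of_ne fun hi => ?_
    rw [← hi, zero_smul, zero_add] at hs
    have e : w j • n j = w k • -n k := by rw [smul_neg]; exact eq_neg_of_add_eq_zero_left hs
    have hjk : w j = w k := by
      have := congrArg norm e
      rwa [norm_smul, norm_smul, norm_neg, hnn, hnn, Real.norm_of_nonneg (hw0 j),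
        Real.norm_of_nonneg (hw0 k), mul_one, mul_one] at this
    rw [hjk] at e
    exact hanti j k (smul_right_injective _ (by intro h; linarith) e)
  have hw : ∀ i, 0 < w i := by
    rw [Fin.sum_univ_three] at h0 hw1
    intro i
    fin_cases i
    · exact key 0 1 2 h0 hw1
    · exact key 1 0 2 (by rw [← h0]; abel) (by linarith)
    · exact key 2 0 1 (by rw [← h0]; abel) (by linarith)
  have hP : ∀ i, ∃ P ∈ K, inner ℝ (n i) (P - O) ≤ -(1 - r) := fun i => by
    obtain ⟨x, hx, y, hy, hxy⟩ := exists_le_inner_sub_of_width hK (hnn i)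
    refine ⟨y, hy, ?_⟩
    have h1 := (hn i).2 x hx
    rw [real_inner_comm, show x - y = (x - O) - (y - O) by abel, inner_sub_right] at hxy
    linarith
  choose P hPK hP using hP
  have hthird : 1 / 3 ≤ r := by
    -- The relation is paired with `P i - O`; adding the three bounds gives `1 - r ≤ 2 * r`.
    have b0 : ∀ i j k : Fin 3, w i • n i + w j • n j + w k • n k = 0 →
        w i * (1 - r) ≤ (w j + w k) * r := fun i j k hs => by
      have h1 : inner ℝ (w i • n i + w j • n j + w k • n k) (P i - O) = 0 := by
        rw [hs, inner_zero_left]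
      rw [inner_add_left, inner_add_left, inner_smul_left, inner_smul_left, inner_smul_left] at h1
      simp only [conj_trivial] at h1
      have a0 := mul_le_mul_of_nonneg_left (hP i) (hw0 i)
      have a1 := mul_le_mul_of_nonneg_left ((hn j).2 _ (hPK i)) (hw0 j)
      have a2 := mul_le_mul_of_nonneg_left ((hn k).2 _ (hPK i)) (hw0 k)
      linarith
    rw [Fin.sum_univ_three] at h0 hw1
    have c0 := b0 0 1 2 h0
    have c1 := b0 1 0 2 (by rw [← h0]; abel)
    have c2 := b0 2 0 1 (by rw [← h0]; abel)
    nlinarith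
  refine ⟨hthird, ?_⟩
  have hnorm : ∀ i, 1 - r ≤ ‖P i - O‖ := fun i => by
    have := abs_real_inner_le_norm (n i) (P i - O)
    rw [hnn, one_mul] at this
    linarith [neg_abs_le (inner ℝ (n i) (P i - O)), hP i]
  -- The point of the segment from `O` to `P i` at distance `1 - r` from `O`, hence in `K` by
  -- convexity.
  set A : Fin 3 → Plane := fun i => O + ((1 - r) / ‖P i - O‖) • (P i - O) with hA
  have hpos : ∀ i, 0 < ‖P i - O‖ := fun i => by linarith [hnorm i]
  have hs0 : ∀ i, 0 ≤ (1 - r) / ‖P i - O‖ := fun i => div_nonneg (by linarith) (hpos i).le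
  have hs1 : ∀ i, (1 - r) / ‖P i - O‖ ≤ 1 := fun i => (div_le_one (hpos i)).2 (hnorm i)
  have hAd : ∀ i, dist (A i) O = 1 - r := fun i => by
    have := (hpos i).ne'
    simp only [hA]
    rw [dist_self_add_left, norm_smul, Real.norm_of_nonneg (hs0 i)]
    field_simp
  have hOK : O ∈ K := hO (Metric.mem_closedBall_self hr0)
  have hAK : ∀ i, A i ∈ K := fun i => by
    have := hconv.add_smul_sub_mem hOK (hPK i) ⟨hs0 i, hs1 i⟩
    exact this
  -- Seen from `O`, the cap lies in the cone of the two normals other than `n i`, off its edges. A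
  -- point common to two caps would make the same vanishing coefficient have two different indices.
  have hcap : ∀ i x, x ∈ cap O r (A i) → ∀ c : Fin 3 → ℝ, (∀ i, 0 ≤ c i) →
      ‖x - O‖⁻¹ • (x - O) = ∑ i, c i • n i → ∀ k, c k = 0 → k = i := by
    intro i x hx c hc hxc k hk
    by_contra hki
    obtain ⟨u, hu, hux, hur⟩ := inner_gt_of_mem_cap hr0 hx
    rw [← hux] at hxc
    -- `A i - O` is `P i - O` times a factor in `[0, 1]`, so the larger vector also exceeds the
    -- nonnegative bound `r`.
    have hle : r < inner ℝ u (P i - O) := by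
      simp only [hA, add_sub_cancel_left, inner_smul_right] at hur
      have hs0 := hs0 i
      have hs1 := hs1 i
      have : 0 ≤ inner ℝ u (P i - O) := by
        by_contra! hneg
        nlinarith
      nlinarith
    obtain ⟨l, hl⟩ : ∃ l, u = c i • n i + c l • n l := by
      rw [Fin.sum_univ_three] at hxc
      rw [hxc]
      have h3 : ∀ i k : Fin 3, k ≠ i → ∃ l, ∀ f : Fin 3 → Plane, f k = 0 →
          f 0 + f 1 + f 2 = f i + f l := by
        intro i k hki
        have hl : ∃ l : Fin 3, l ≠ i ∧ l ≠ k := by decide +revert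
        obtain ⟨l, hli, hlk⟩ := hl
        refine ⟨l, fun f hf => ?_⟩
        rw [← Fin.sum_univ_three, ← Finset.sum_subset (Finset.subset_univ {i, l}) ?_,
          Finset.sum_pair hli.symm]
        intro x _ hx
        have : x = k := by
          simp only [Finset.mem_insert, Finset.mem_singleton, not_or] at hx
          omega
        rw [this, hf]
      obtain ⟨l, hl⟩ := h3 i k hki
      exact ⟨l, hl (fun j => c j • n j) (by simp [hk])⟩
    have := inner_le_of_mem_cone hu (hnn i) (hnn l) (hc i) (hc l) hr0 hl
      ((hP i).trans (by linarith)) ((hn l).2 _ (hPK i))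
    linarith
  have hdisj : ∀ i j, i ≠ j → Disjoint (cap O r (A i)) (cap O r (A j)) := fun i j hij => by
    rw [Set.disjoint_left]
    intro x hxi hxj
    obtain ⟨c, hc0, ⟨k, hk⟩, hc⟩ :=
      exists_cone_of_not_antipodal hnn hw h0 hanti (‖x - O‖⁻¹ • (x - O))
    exact hij ((hcap i x hxi c hc0 hc k hk).symm.trans (hcap j x hxj c hc0 hc k hk))
  refine ⟨_, ⟨⟨hthird, hlt.le⟩, O, A 0, A 1, A 2, hAd 0, hAd 1, hAd 2, hdisj 0 1 (by decide),
    hdisj 1 2 (by decide), hdisj 2 0 (by decide), rfl⟩, ?_⟩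
  refine convexHull_min (union_subset hO ?_) hconv
  simp [insert_subset_iff, hAK]

lemma inradius_mem_and_exists_isThreeCap {K : Set Plane} (hK : K ∈ shapesOfMinimalWidth 1) :
    inradius K ∈ Icc (1 / 3 : ℝ) (1 / 2) ∧ ∃ T : Set Plane, IsThreeCap (inradius K) T ∧ T ⊆ K := by
  obtain ⟨O, hO⟩ := exists_closedBall_inradius_subset hK.2.1 hK.2.2.1
  obtain ⟨θ, -, hθ⟩ := hK.2.2.2.1
  have hle := two_mul_le_width hK.2.1 (inradius_nonneg K) hO θ
  rw [hθ] at hle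
  rcases (show inradius K ≤ 1 / 2 by linarith).lt_or_eq with hlt | heq
  · obtain ⟨h1, h2⟩ := exists_isThreeCap_of_inradius_lt_half (shapesOfMinimalWidth_subset 1 hK) hlt
    exact ⟨⟨h1, hlt.le⟩, h2⟩
  · rw [heq] at hO ⊢
    exact ⟨by norm_num, _, isThreeCap_closedBall O, hO⟩

/-- The inradius may exceed 1/2 here; the incircle is then shrunk to radius 1/2. -/
lemma exists_isThreeCap_subset {K : Set Plane} (hK : K ∈ shapesOfWidthAtLeast 1) :
    ∃ (r : ℝ) (T : Set Plane), IsThreeCap r T ∧ T ⊆ K := by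
  rcases lt_or_ge (inradius K) (1 / 2) with hlt | hge
  · exact ⟨_, (exists_isThreeCap_of_inradius_lt_half hK hlt).2⟩
  · obtain ⟨O, hO⟩ := exists_closedBall_inradius_subset hK.2.1 hK.2.2.1
    exact ⟨_, _, isThreeCap_closedBall O, (Metric.closedBall_subset_closedBall hge).trans hO⟩

lemma IsThreeCap.convex {r : ℝ} {T : Set Plane} (hT : IsThreeCap r T) : Convex ℝ T := by
  obtain ⟨-, O, A, B, C, -, -, -, -, -, -, rfl⟩ := hT
  exact convex_convexHull ℝ _

lemma IsThreeCap.isCompact {r : ℝ} {T : Set Plane} (hT : IsThreeCap r T) : IsCompact T := by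
  obtain ⟨-, O, A, B, C, -, -, -, -, -, -, rfl⟩ := hT
  exact isCompact_convexHull_plane ((isCompact_closedBall O r).union (by simp))

lemma IsThreeCap.interior_nonempty {r : ℝ} {T : Set Plane} (hT : IsThreeCap r T) :
    (interior T).Nonempty := by
  obtain ⟨⟨hr, -⟩, O, A, B, C, -, -, -, -, -, -, rfl⟩ := hT
  have h : Metric.ball O r ⊆ convexHull ℝ (Metric.closedBall O r ∪ {A, B, C}) :=
    Metric.ball_subset_closedBall.trans (subset_union_left.trans (subset_convexHull ℝ _))
  exact ⟨O, interior_maximal h Metric.isOpen_ball (Metric.mem_ball_self (by linarith))⟩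

/-! ### Scaling and the equilateral triangle -/

lemma width_smul {c : ℝ} (hc : 0 < c) (K : Set Plane) (θ : ℝ) :
    width (c • K) θ = c * width K θ := by
  have h : (fun x : Plane => inner ℝ x (direction θ)) '' (c • K) =
      c • ((fun x : Plane => inner ℝ x (direction θ)) '' K) := by
    rw [← image_smul, ← image_smul, image_image, image_image]
    simp [inner_smul_left]
  rw [width, h, Real.sSup_smul_of_nonneg hc.le, Real.sInf_smul_of_nonneg hc.le, width, smul_eq_mul,
    smul_eq_mul, mul_sub]

lemma smul_mem_shapesOfWidthAtLeast {w c : ℝ} (hc : 0 < c) {K : Set Plane}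
    (hK : K ∈ shapesOfWidthAtLeast w) : c • K ∈ shapesOfWidthAtLeast (c * w) := by
  obtain ⟨h1, h2, h3, h4⟩ := hK
  refine ⟨h1.smul c, h2.smul c, h3.smul_set, fun θ hθ => ?_⟩
  rw [width_smul hc]
  exact mul_le_mul_of_nonneg_left (h4 θ hθ) hc.le

lemma smul_mem_shapesOfMinimalWidth {w c : ℝ} (hc : 0 < c) {K : Set Plane}
    (hK : K ∈ shapesOfMinimalWidth w) : c • K ∈ shapesOfMinimalWidth (c * w) := by
  obtain ⟨h1, h2, h3, ⟨θ, hθ, hw⟩, -⟩ := id hK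
  refine ⟨h1.smul c, h2.smul c, h3.smul_set, ⟨θ, hθ, ?_⟩, ?_⟩
  · rw [width_smul hc, hw]
  · rintro _ ⟨θ', hθ', rfl⟩
    exact (smul_mem_shapesOfWidthAtLeast hc (shapesOfMinimalWidth_subset w hK)).2.2.2 θ' hθ'

lemma parseval_of_inner_eq_zero {p r : Plane} (hp : p ≠ 0) (h : inner ℝ p r = 0) (u : Plane) :
    inner ℝ p u ^ 2 * ‖r‖ ^ 2 + inner ℝ r u ^ 2 * ‖p‖ ^ 2 = ‖u‖ ^ 2 * ‖p‖ ^ 2 * ‖r‖ ^ 2 := by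
  have hpp : ‖p‖ ^ 2 ≠ 0 := by simpa using hp
  simp only [EuclideanSpace.norm_sq_eq, Fin.sum_univ_two, PiLp.inner_apply, RCLike.inner_apply,
    conj_trivial, Real.norm_eq_abs, sq_abs] at h hpp ⊢
  -- In the plane, `r` is `t` times the quarter turn of `p`.
  set t := (p 0 * r 1 - p 1 * r 0) / (p 0 ^ 2 + p 1 ^ 2) with ht
  have h0 : r 0 = -t * p 1 := by rw [ht]; field_simp; linear_combination p 0 * h
  have h1 : r 1 = t * p 0 := by rw [ht]; field_simp; linear_combination p 1 * h
  rw [h0, h1]; ring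

/-- The width is 1 along an altitude. In any direction the projections `a`, `b`, `a + b` of the
sides satisfy `a² + ab + b² = 1`, which forces one of them to have absolute value at least 1. -/
lemma IsEquilateralTriangle.mem_shapesOfMinimalWidth {Te : Set Plane}
    (hT : IsEquilateralTriangle 1 Te) : Te ∈ shapesOfMinimalWidth 1 := by
  obtain ⟨A, B, C, s, hs, hs1, hAB, hBC, hCA, rfl⟩ := hT
  have hs2 : 3 / 4 * s ^ 2 = 1 := by
    have h3 : Real.sqrt 3 ^ 2 = 3 := Real.sq_sqrt (by norm_num)
    have : (Real.sqrt 3 / 2 * s) ^ 2 = 1 := by rw [← hs1]; norm_num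
    rw [← this, mul_pow, div_pow, h3]; norm_num
  have hA : A ∈ convexHull ℝ {A, B, C} := subset_convexHull ℝ _ (by simp)
  have hB : B ∈ convexHull ℝ {A, B, C} := subset_convexHull ℝ _ (by simp)
  have hC : C ∈ convexHull ℝ {A, B, C} := subset_convexHull ℝ _ (by simp)
  have hcomp : IsCompact (convexHull ℝ {A, B, C}) := isCompact_convexHull_plane (by simp)
  set p := A - B with hp
  set q := B - C with hq
  have hpn : ‖p‖ ^ 2 = s ^ 2 := by rw [hp, ← dist_eq_norm, hAB]
  have hqn : ‖q‖ ^ 2 = s ^ 2 := by rw [hq, ← dist_eq_norm, hBC]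
  have hpq : inner ℝ p q = -s ^ 2 / 2 := by
    have h1 : ‖p + q‖ ^ 2 = s ^ 2 := by
      rw [show p + q = A - C by rw [hp, hq]; abel, ← dist_eq_norm, dist_comm, hCA]
    rw [norm_add_sq_real, hpn, hqn] at h1
    linarith
  have hp0 : p ≠ 0 := by
    intro h; rw [h, norm_zero] at hpn; nlinarith
  -- The altitude from `C` to the midpoint of `AB`.
  set r := q + (1 / 2 : ℝ) • p with hr
  have hpr : inner ℝ p r = 0 := by
    rw [hr, inner_add_right, inner_smul_right, real_inner_self_eq_norm_sq, hpq, hpn]; ring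
  have hrn : ‖r‖ ^ 2 = 1 := by
    rw [hr, norm_add_sq_real, hqn, inner_smul_right, real_inner_comm, hpq, norm_smul, mul_pow, hpn,
      Real.norm_of_nonneg (by norm_num)]
    linarith
  refine ⟨convex_convexHull ℝ _, hcomp, ⟨A, hA⟩, ?_, ?_⟩
  · have hr1 : ‖r‖ = 1 := by nlinarith [norm_nonneg r]
    obtain ⟨θ, hθ, hθr⟩ := exists_direction_eq hr1
    refine ⟨θ, hθ, le_antisymm ?_ ?_⟩
    · obtain ⟨x, hx, y, hy, hxy⟩ := exists_inner_sub_eq_width hcomp ⟨A, hA⟩ θ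
      rw [← hxy, hθr]
      have hrq : inner ℝ r (B - C) = 1 := by
        have : q = r - (1 / 2 : ℝ) • p := by rw [hr]; abel
        rw [← hq, this, inner_sub_right, inner_smul_right, real_inner_comm p r, hpr,
          real_inner_self_eq_norm_sq, hrn]; ring
      have hrp : inner ℝ r (A - B) = 0 := by rw [← hp, real_inner_comm, hpr]
      rw [inner_sub_right] at hrq hrp
      have hup : convexHull ℝ {A, B, C} ⊆ {z | inner ℝ r z ≤ inner ℝ r A} := by
        refine convexHull_min ?_ (convex_halfSpace_le (innerₗ Plane r).isLinear _)
        rintro z (rfl | rfl | rfl) <;> simp only [mem_ofPred_eq] <;> linarith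
      have hlo : convexHull ℝ {A, B, C} ⊆ {z | inner ℝ r C ≤ inner ℝ r z} := by
        refine convexHull_min ?_ (convex_halfSpace_ge (innerₗ Plane r).isLinear _)
        rintro z (rfl | rfl | rfl) <;> simp only [mem_ofPred_eq] <;> linarith
      have h1 := hup hx
      have h2 := hlo hy
      simp only [mem_ofPred_eq] at h1 h2
      rw [real_inner_comm, inner_sub_right]
      linarith
    · have := inner_sub_le_width hcomp hB hC θ
      rw [hθr, ← hq] at this
      have e : inner ℝ q r = 1 := by
        have : q = r - (1 / 2 : ℝ) • p := by rw [hr]; abel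
        rw [this, inner_sub_left, inner_smul_left, hpr, real_inner_self_eq_norm_sq, hrn]; simp
      linarith
  · rintro _ ⟨θ, -, rfl⟩
    have hpar := parseval_of_inner_eq_zero hp0 hpr (direction θ)
    rw [norm_direction, hrn, hpn] at hpar
    have hrd : inner ℝ r (direction θ) = inner ℝ q (direction θ) + 1 / 2 * inner ℝ p (direction θ) := by
      rw [hr, inner_add_left, inner_smul_left, conj_trivial]
    rw [hrd] at hpar
    have hs3 : s ^ 2 = 4 / 3 := by linarith
    have a1 := inner_sub_le_width hcomp hA hB θ
    have a2 := inner_sub_le_width hcomp hB hA θ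
    have b1 := inner_sub_le_width hcomp hB hC θ
    have b2 := inner_sub_le_width hcomp hC hB θ
    have c1 := inner_sub_le_width hcomp hA hC θ
    have c2 := inner_sub_le_width hcomp hC hA θ
    rw [show B - A = -p by rw [hp]; abel, inner_neg_left] at a2
    rw [show C - B = -q by rw [hq]; abel, inner_neg_left] at b2
    rw [show A - C = p + q by rw [hp, hq]; abel, inner_add_left] at c1
    rw [show C - A = -(p + q) by rw [hp, hq]; abel, inner_neg_left, inner_add_left] at c2
    rw [← hp] at a1
    rw [← hq] at b1
    set a := inner ℝ p (direction θ)
    set b := inner ℝ q (direction θ)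
    set W := width _ θ
    by_contra! hW
    have hab : a ^ 2 + a * b + b ^ 2 = 1 := by rw [hs3] at hpar; linarith
    have hW0 : 0 ≤ W := by linarith
    have hWW : W ^ 2 < 1 := by nlinarith
    have ha : a ^ 2 ≤ W ^ 2 := sq_le_sq' (by linarith) a1
    have hb : b ^ 2 ≤ W ^ 2 := sq_le_sq' (by linarith) b1
    have hc : (a + b) ^ 2 ≤ W ^ 2 := sq_le_sq' (by linarith) c1
    -- If `ab ≥ 0` then `(a + b)² = 1 + ab ≥ 1`. If `ab ≤ 0`, this inequality shows that the larger
    -- of `a²`, `b²` is at least 1.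
    have key : ∀ x y : ℝ, x * y ≤ 0 → x ^ 2 ≤ y ^ 2 → x ^ 2 ≤ -(x * y) := fun x y h h' => by
      refine (le_abs_self _).trans (abs_le_of_sq_le_sq ?_ (by linarith))
      calc (x ^ 2) ^ 2 = x ^ 2 * x ^ 2 := by ring
        _ ≤ x ^ 2 * y ^ 2 := mul_le_mul_of_nonneg_left h' (sq_nonneg x)
        _ = (-(x * y)) ^ 2 := by ring
    rcases le_total 0 (a * b) with h | h
    · have : (a + b) ^ 2 = a ^ 2 + 2 * (a * b) + b ^ 2 := by ring
      linarith
    · rcases le_total (a ^ 2) (b ^ 2) with h' | h'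
      · linarith [key a b h h']
      · linarith [key b a (by linarith) h', mul_comm a b]

/-! ### Scaling and monotonicity of the Cheeger constant. -/

lemma perimeter_smul {c : ℝ} (hc : 0 < c) (E : Set Plane) :
    perimeter (c • E) = ENNReal.ofReal c * perimeter E := by
  have h : frontier (c • E) = c • frontier E := by
    rw [frontier, frontier, closure_smul₀, interior_smul₀ hc.ne', smul_set_sdiff₀ hc.ne']
  rw [perimeter, h, Measure.hausdorffMeasure_smul₀ zero_le_one hc.ne', perimeter]
  simp [ENNReal.smul_def, Real.toNNReal, ENNReal.ofReal, nnnorm, Real.norm_of_nonneg hc.le, hc.le]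

lemma volume_smul_plane {c : ℝ} (hc : 0 < c) (E : Set Plane) :
    volume (c • E) = ENNReal.ofReal c ^ 2 * volume E := by
  rw [Measure.addHaar_smul_of_nonneg _ hc.le]
  simp [ENNReal.ofReal_pow hc.le]

/-- Each competitor is scaled by `c`. The reverse inequality is this one for `c⁻¹` and `c • K`. -/
lemma cheeger_smul_le {c : ℝ} (hc : 0 < c) (K : Set Plane) :
    cheeger (c • K) ≤ (ENNReal.ofReal c)⁻¹ * cheeger K := by
  have hc0 : ENNReal.ofReal c ≠ 0 := by simpa using hc
  have hct : ENNReal.ofReal c ≠ ⊤ := ENNReal.ofReal_ne_top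
  rw [mul_comm, ← div_eq_mul_inv, ENNReal.le_div_iff_mul_le (.inl hc0) (.inl hct)]
  refine le_iInf₂ fun E hE => ?_
  have h1 : cheeger (c • K) ≤ perimeter (c • E) / volume (c • E) := by
    refine iInf₂_le (c • E) ⟨hE.1.smul c, smul_set_mono hE.2.1, ?_⟩
    rw [volume_smul_plane hc]
    exact ENNReal.mul_pos (pow_ne_zero 2 hc0) hE.2.2.ne'
  calc cheeger (c • K) * ENNReal.ofReal c
      ≤ perimeter (c • E) / volume (c • E) * ENNReal.ofReal c := by gcongr
    _ = perimeter E / volume E := by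
      rw [perimeter_smul hc, volume_smul_plane hc, pow_two, mul_assoc,
        ENNReal.mul_div_mul_left _ _ hc0 hct, div_eq_mul_inv,
        ENNReal.mul_inv (.inl hc0) (.inl hct), div_eq_mul_inv, mul_assoc, mul_assoc,
        mul_comm (volume E)⁻¹, ← mul_assoc (ENNReal.ofReal c)⁻¹, ENNReal.inv_mul_cancel hc0 hct, one_mul]

lemma cheeger_mono {T K : Set Plane} (h : T ⊆ K) : cheeger K ≤ cheeger T :=
  le_iInf₂ fun E hE => iInf₂_le E ⟨hE.1, hE.2.1.trans h, hE.2.2⟩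

/-! ### Poincaré inequalities for test functions -/

/-- The energy density `|∇f|²`, with values in `[0, ∞]`. -/
def energyDensity (f : Plane → ℝ) (x : Plane) : ℝ≥0∞ := ENNReal.ofReal (‖gradient f x‖ ^ 2)

lemma continuous_gradient {f : Plane → ℝ} (hf : ContDiff ℝ ∞ f) : Continuous (gradient f) :=
  (InnerProductSpace.toDual ℝ Plane).symm.continuous.comp (hf.continuous_fderiv (by simp))

lemma measurable_energyDensity {f : Plane → ℝ} (hf : ContDiff ℝ ∞ f) :
    Measurable (energyDensity f) :=
  (ENNReal.continuous_ofReal.comp ((continuous_gradient hf).norm.pow 2)).measurable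

/-- The variance of `h` on the unit interval is nonnegative. -/
lemma sq_integral_le {h : ℝ → ℝ} (hc : Continuous h) :
    (∫ t in (0 : ℝ)..1, h t) ^ 2 ≤ ∫ t in (0 : ℝ)..1, h t ^ 2 := by
  set c := ∫ t in (0 : ℝ)..1, h t with hcdef
  have h0 : 0 ≤ ∫ t in (0 : ℝ)..1, (h t - c) ^ 2 :=
    intervalIntegral.integral_nonneg zero_le_one fun t _ => sq_nonneg _
  have h1 : ∫ t in (0 : ℝ)..1, (h t - c) ^ 2 = (∫ t in (0 : ℝ)..1, h t ^ 2) - c ^ 2 := by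
    have : ∀ t, (h t - c) ^ 2 = h t ^ 2 - 2 * c * h t + c ^ 2 := fun t => by ring
    simp_rw [this]
    rw [intervalIntegral.integral_add, intervalIntegral.integral_sub,
      intervalIntegral.integral_const_mul, ← hcdef, intervalIntegral.integral_const]
    · simp; ring
    all_goals exact Continuous.intervalIntegrable (by fun_prop) _ _
  linarith

/-- The fundamental theorem of calculus along the segment, then Cauchy–Schwarz. Values in `[0, ∞]`
let Tonelli apply later without integrability conditions. -/
lemma ofReal_sq_sub_le {f : Plane → ℝ} (hf : ContDiff ℝ ∞ f) (x y : Plane) :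
    ENNReal.ofReal ((f x - f y) ^ 2) ≤ ENNReal.ofReal (‖x - y‖ ^ 2) *
      ∫⁻ t in Icc (0 : ℝ) 1, energyDensity f (y + t • (x - y)) := by
  have hg := continuous_gradient hf
  set h : ℝ → ℝ := fun t => inner ℝ (gradient f (y + t • (x - y))) (x - y) with hh
  have hhc : Continuous h := by fun_prop
  have hderiv : ∀ t : ℝ, HasDerivAt (fun t : ℝ => f (y + t • (x - y))) (h t) t := fun t => by
    have h1 : HasDerivAt (fun t : ℝ => y + t • (x - y)) (x - y) t := by
      simpa using ((hasDerivAt_id t).smul_const (x - y)).const_add y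
    have h2 := ((hf.differentiable (by simp)) (y + t • (x - y))).hasFDerivAt.comp_hasDerivAt t h1
    rwa [← inner_gradient_left] at h2
  have hint : ∫ t in (0 : ℝ)..1, h t = f x - f y := by
    rw [intervalIntegral.integral_eq_sub_of_hasDerivAt (fun t _ => hderiv t)
      (hhc.intervalIntegrable _ _)]
    simp
  have hle : (f x - f y) ^ 2 ≤
      ‖x - y‖ ^ 2 * ∫ t in (0 : ℝ)..1, ‖gradient f (y + t • (x - y))‖ ^ 2 := by
    rw [← hint, ← intervalIntegral.integral_const_mul]
    refine (sq_integral_le hhc).trans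
      (intervalIntegral.integral_mono_on zero_le_one
        (Continuous.intervalIntegrable (by fun_prop) _ _)
        (Continuous.intervalIntegrable (by fun_prop) _ _) fun t _ => ?_)
    have := abs_real_inner_le_norm (gradient f (y + t • (x - y))) (x - y)
    calc h t ^ 2 = |h t| ^ 2 := (sq_abs _).symm
      _ ≤ (‖gradient f (y + t • (x - y))‖ * ‖x - y‖) ^ 2 :=
        pow_le_pow_left₀ (abs_nonneg _) this 2
      _ = _ := by ring
  refine (ENNReal.ofReal_le_ofReal hle).trans_eq ?_
  rw [ENNReal.ofReal_mul (by positivity), intervalIntegral.integral_of_le zero_le_one,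
    ← integral_Icc_eq_integral_Ioc, ofReal_integral_eq_lintegral_ofReal]
  · rfl
  · exact Continuous.integrableOn_Icc (by fun_prop)
  · exact ae_of_all _ fun t => by positivity

lemma lintegral_comp_add_smul {h : Plane → ℝ≥0∞} (hh : Measurable h) (a : Plane) {t : ℝ}
    (ht : t ≠ 0) : ∫⁻ x, h (a + t • x) = ENNReal.ofReal ((t ^ 2)⁻¹) * ∫⁻ x, h x := by
  have h1 : ∫⁻ x, h (a + t • x) = ∫⁻ z, h (a + z) ∂(Measure.map (t • ·) volume) := by
    rw [lintegral_map (by fun_prop) (by fun_prop)]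
  rw [h1, Measure.map_addHaar_smul _ ht, lintegral_smul_measure, lintegral_add_left_eq_self h a,
    smul_eq_mul]
  simp

lemma IsTestFunction.eq_zero_of_notMem {K : Set Plane} {φ : Plane → ℝ} (hφ : IsTestFunction K φ)
    {x : Plane} (hx : x ∉ K) : φ x = 0 :=
  image_eq_zero_of_notMem_tsupport fun h => hx (interior_subset (hφ.2.2 h))

lemma IsTestFunction.gradient_eq_zero_of_notMem {K : Set Plane} {φ : Plane → ℝ}
    (hφ : IsTestFunction K φ) {x : Plane} (hx : x ∉ K) : gradient φ x = 0 := by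
  have h : x ∉ tsupport (fderiv ℝ φ) := fun h =>
    hx (interior_subset (hφ.2.2 (tsupport_fderiv_subset ℝ h)))
  rw [gradient, image_eq_zero_of_notMem_tsupport h, map_zero]

lemma IsTestFunction.hasCompactSupport_gradient {K : Set Plane} {φ : Plane → ℝ}
    (hφ : IsTestFunction K φ) : HasCompactSupport (gradient φ) :=
  (hφ.2.1.fderiv ℝ).comp_left (map_zero (InnerProductSpace.toDual ℝ Plane).symm)

lemma IsTestFunction.integrable_sq {K : Set Plane} {φ : Plane → ℝ} (hφ : IsTestFunction K φ) :
    Integrable fun x => φ x ^ 2 :=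
  Continuous.integrable_of_hasCompactSupport (hφ.1.continuous.pow 2)
    (.intro hφ.2.1.isCompact fun x hx => by simp [image_eq_zero_of_notMem_tsupport hx])

lemma IsTestFunction.integrable {K : Set Plane} {φ : Plane → ℝ} (hφ : IsTestFunction K φ) :
    Integrable φ :=
  hφ.1.continuous.integrable_of_hasCompactSupport hφ.2.1

lemma IsTestFunction.integrable_norm_gradient_sq {K : Set Plane} {φ : Plane → ℝ}
    (hφ : IsTestFunction K φ) : Integrable fun x => ‖gradient φ x‖ ^ 2 :=
  Continuous.integrable_of_hasCompactSupport ((continuous_gradient hφ.1).norm.pow 2)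
    (.intro hφ.hasCompactSupport_gradient.isCompact fun x hx => by
      simp [image_eq_zero_of_notMem_tsupport hx])

lemma lintegral_energyDensity {K : Set Plane} {φ : Plane → ℝ} (hφ : IsTestFunction K φ)
    (s : Set Plane) :
    ∫⁻ x in s, energyDensity φ x = ENNReal.ofReal (∫ x in s, ‖gradient φ x‖ ^ 2) := by
  rw [ofReal_integral_eq_lintegral_ofReal hφ.integrable_norm_gradient_sq.integrableOn
    (ae_of_all _ fun t => by positivity)]
  rfl

/-- The Poincaré inequality with zero boundary values. -/
lemma exists_poincare {K : Set Plane} (hK : Bornology.IsBounded K) :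
    ∃ C : ℝ, 0 < C ∧ ∀ φ, IsTestFunction K φ → ∫ x, φ x ^ 2 ≤ C * ∫ x, ‖gradient φ x‖ ^ 2 := by
  obtain ⟨ρ, hρ0, hρ⟩ := hK.exists_pos_norm_le
  -- Larger than the diameter of `K`, so translation by `R • e` carries each point of `K` to one
  -- where `φ` vanishes.
  set R := 2 * ρ + 1 with hR
  have hR0 : 0 < R := by positivity
  refine ⟨R ^ 2, by positivity, fun φ hφ => ?_⟩
  set e := direction 0 with he
  have hpt : ∀ x, ENNReal.ofReal (φ x ^ 2) ≤ ENNReal.ofReal (R ^ 2) *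
      ∫⁻ t in Icc (0 : ℝ) 1, energyDensity φ (t • (R • e) + x) := fun x => by
    by_cases hx : x ∈ K
    · have hxe : x + R • e ∉ K := fun h => by
        have h1 := hρ _ h
        have h2 := hρ _ hx
        have h3 := norm_sub_le (x + R • e) x
        rw [add_sub_cancel_left, norm_smul, he, norm_direction, Real.norm_of_nonneg hR0.le] at h3
        rw [← he] at h3
        linarith
      have := ofReal_sq_sub_le hφ.1 (x + R • e) x
      rw [hφ.eq_zero_of_notMem hxe, zero_sub, neg_sq, add_sub_cancel_left, norm_smul, he,
        norm_direction, mul_one, Real.norm_of_nonneg hR0.le] at this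
      simpa only [add_comm x] using this
    · simp [hφ.eq_zero_of_notMem hx]
  have hmeas := measurable_energyDensity hφ.1
  have hlint : ∫⁻ x, ENNReal.ofReal (φ x ^ 2) ≤ ENNReal.ofReal (R ^ 2) * ∫⁻ x, energyDensity φ x := by
    refine (lintegral_mono hpt).trans_eq ?_
    rw [lintegral_const_mul _ (by
      exact Measurable.lintegral_prod_left' (f := fun p : ℝ × Plane => energyDensity φ (p.1 • (R • e) + p.2)) (by fun_prop)),
      lintegral_lintegral_swap (by
        exact (show Measurable fun p : Plane × ℝ => energyDensity φ (p.2 • (R • e) + p.1) by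
          fun_prop).aemeasurable)]
    simp_rw [lintegral_add_left_eq_self (energyDensity φ)]
    simp
  rw [← setLIntegral_univ (energyDensity φ), lintegral_energyDensity hφ, setIntegral_univ,
    ← ofReal_integral_eq_lintegral_ofReal hφ.integrable_sq (ae_of_all _ fun t => by positivity),
    ← ENNReal.ofReal_mul (by positivity)] at hlint
  refine (ENNReal.ofReal_le_ofReal_iff ?_).1 hlint
  exact mul_nonneg (by positivity) (integral_nonneg fun x => by positivity)

/-- The contraction towards `y` maps `Q` into itself and has Jacobian `t² ≥ 1/4`. -/
lemma setLIntegral_comp_segment_le {h : Plane → ℝ≥0∞} (hh : Measurable h) {Q : Set Plane}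
    (hQ : Convex ℝ Q) (hQm : MeasurableSet Q) {t : ℝ} (ht : t ∈ Icc (1 / 2 : ℝ) 1) {y : Plane}
    (hy : y ∈ Q) : ∫⁻ x in Q, h (y + t • (x - y)) ≤ 4 * ∫⁻ x in Q, h x := by
  have ht0 : t ≠ 0 := by linarith [ht.1]
  calc ∫⁻ x in Q, h (y + t • (x - y))
      ≤ ∫⁻ x, Q.indicator h ((y - t • y) + t • x) := by
        rw [← lintegral_indicator hQm]
        refine lintegral_mono fun x => ?_
        by_cases hx : x ∈ Q
        · have hmem : y + t • (x - y) ∈ Q :=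
            hQ.add_smul_sub_mem hy hx ⟨by linarith [ht.1], ht.2⟩
          have e : (y - t • y) + t • x = y + t • (x - y) := by module
          rw [indicator_of_mem hx, e, indicator_of_mem hmem]
        · rw [indicator_of_notMem hx]; exact zero_le
    _ = ENNReal.ofReal ((t ^ 2)⁻¹) * ∫⁻ x in Q, h x := by
        rw [lintegral_comp_add_smul (hh.indicator hQm) _ ht0, lintegral_indicator hQm]
    _ ≤ 4 * ∫⁻ x in Q, h x := by
        gcongr
        rw [← ENNReal.ofReal_ofNat]
        refine ENNReal.ofReal_le_ofReal (inv_le_of_inv_le₀ (by norm_num) ?_)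
        nlinarith [ht.1]

/-- The Jacobian factor degenerates as `t → 0`, so for `t ≤ 1/2` the roles of `x` and `y` are
exchanged. -/
lemma lintegral_lintegral_segment_le {h : Plane → ℝ≥0∞} (hh : Measurable h) {Q : Set Plane}
    (hQ : Convex ℝ Q) (hQm : MeasurableSet Q) {t : ℝ} (ht : t ∈ Icc (0 : ℝ) 1) :
    ∫⁻ x in Q, ∫⁻ y in Q, h (y + t • (x - y)) ≤ 4 * (∫⁻ x in Q, h x) * volume Q := by
  rcases le_total t (1 / 2) with h2 | h2
  · calc ∫⁻ x in Q, ∫⁻ y in Q, h (y + t • (x - y))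
        = ∫⁻ x in Q, ∫⁻ y in Q, h (x + (1 - t) • (y - x)) := by
          refine lintegral_congr fun x => lintegral_congr fun y => ?_
          congr 1; module
      _ ≤ ∫⁻ x in Q, 4 * ∫⁻ x in Q, h x := by
          refine setLIntegral_mono' hQm fun x hx => ?_
          exact setLIntegral_comp_segment_le hh hQ hQm ⟨by linarith, by linarith [ht.1]⟩ hx
      _ = _ := by rw [setLIntegral_const]
  · calc ∫⁻ x in Q, ∫⁻ y in Q, h (y + t • (x - y))
        = ∫⁻ y in Q, ∫⁻ x in Q, h (y + t • (x - y)) := by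
          refine lintegral_lintegral_swap ?_
          exact (show Measurable fun p : Plane × Plane => h (p.2 + t • (p.1 - p.2)) by
            fun_prop).aemeasurable
      _ ≤ ∫⁻ x in Q, 4 * ∫⁻ x in Q, h x := by
          refine setLIntegral_mono' hQm fun x hx => ?_
          exact setLIntegral_comp_segment_le hh hQ hQm ⟨h2, ht.2⟩ hx
      _ = _ := by rw [setLIntegral_const]

lemma lintegral_lintegral_lintegral_rotate {α β γ : Type*} [MeasurableSpace α] [MeasurableSpace β]
    [MeasurableSpace γ] (μ : Measure α) (ν : Measure β) (τ : Measure γ) [SFinite μ] [SFinite ν]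
    [SFinite τ] {F : α → β → γ → ℝ≥0∞} (hF : Measurable fun p : (α × β) × γ => F p.1.1 p.1.2 p.2) :
    ∫⁻ x, ∫⁻ y, ∫⁻ t, F x y t ∂τ ∂ν ∂μ = ∫⁻ t, ∫⁻ x, ∫⁻ y, F x y t ∂ν ∂μ ∂τ := by
  have h1 : ∀ x, ∫⁻ y, ∫⁻ t, F x y t ∂τ ∂ν = ∫⁻ t, ∫⁻ y, F x y t ∂ν ∂τ := fun x => by
    refine lintegral_lintegral_swap (Measurable.aemeasurable ?_)
    exact hF.comp ((measurable_const.prodMk measurable_fst).prodMk measurable_snd)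
  simp_rw [h1]
  refine lintegral_lintegral_swap (Measurable.aemeasurable ?_)
  have h2 : Measurable fun p : (α × γ) × β => F p.1.1 p.2 p.1.2 :=
    hF.comp ((measurable_fst.fst.prodMk measurable_snd).prodMk measurable_fst.snd)
  exact h2.lintegral_prod_right'

lemma lintegral_lintegral_const_mul {α β : Type*} [MeasurableSpace α] [MeasurableSpace β]
    (μ : Measure α) (ν : Measure β) [SFinite ν] (c : ℝ≥0∞) {F : α → β → ℝ≥0∞}
    (hF : Measurable fun p : α × β => F p.1 p.2) :
    ∫⁻ x, ∫⁻ y, c * F x y ∂ν ∂μ = c * ∫⁻ x, ∫⁻ y, F x y ∂ν ∂μ := by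
  rw [← lintegral_const_mul c hF.lintegral_prod_right']
  exact lintegral_congr fun x => lintegral_const_mul c (hF.comp measurable_prodMk_left)

lemma lintegral_lintegral_sq_sub_le {f : Plane → ℝ} (hf : ContDiff ℝ ∞ f) {Q : Set Plane}
    (hQ : Convex ℝ Q) (hQm : MeasurableSet Q) {d : ℝ}
    (hd : ∀ x ∈ Q, ∀ y ∈ Q, ‖x - y‖ ^ 2 ≤ d) :
    ∫⁻ x in Q, ∫⁻ y in Q, ENNReal.ofReal ((f x - f y) ^ 2) ≤
      ENNReal.ofReal d * (4 * (∫⁻ x in Q, energyDensity f x) * volume Q) := by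
  have hm := measurable_energyDensity hf
  have hm3 : Measurable fun p : (Plane × Plane) × ℝ =>
      energyDensity f (p.1.2 + p.2 • (p.1.1 - p.1.2)) := by fun_prop
  have h1 : ∫⁻ x in Q, ∫⁻ y in Q, ENNReal.ofReal ((f x - f y) ^ 2)
      ≤ ∫⁻ x in Q, ∫⁻ y in Q, ENNReal.ofReal d *
          ∫⁻ t in Icc (0 : ℝ) 1, energyDensity f (y + t • (x - y)) := by
    refine setLIntegral_mono' hQm fun x hx => setLIntegral_mono' hQm fun y hy => ?_
    refine (ofReal_sq_sub_le hf x y).trans (mul_le_mul_left ?_ _)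
    exact ENNReal.ofReal_le_ofReal (hd x hx y hy)
  have h2 := lintegral_lintegral_const_mul (volume.restrict Q) (volume.restrict Q)
    (ENNReal.ofReal d) (F := fun x y => ∫⁻ t in Icc (0 : ℝ) 1, energyDensity f (y + t • (x - y)))
    hm3.lintegral_prod_right'
  have h3 := lintegral_lintegral_lintegral_rotate (volume.restrict Q) (volume.restrict Q)
    (volume.restrict (Icc (0 : ℝ) 1)) (F := fun x y t => energyDensity f (y + t • (x - y))) hm3
  have h4 : ∫⁻ t in Icc (0 : ℝ) 1, ∫⁻ x in Q, ∫⁻ y in Q, energyDensity f (y + t • (x - y)) ≤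
      ∫⁻ t in Icc (0 : ℝ) 1, (4 * (∫⁻ x in Q, energyDensity f x) * volume Q) :=
    setLIntegral_mono' measurableSet_Icc fun t ht => lintegral_lintegral_segment_le hm hQ hQm ht
  rw [setLIntegral_const] at h4
  rw [h2, h3] at h1
  refine h1.trans (mul_le_mul_right (h4.trans_eq ?_) _)
  simp

/-- Expanding the square turns the double integral into a variance, which brings in the mean value
of `f`. -/
lemma lintegral_lintegral_sq_sub {f : Plane → ℝ} {Q : Set Plane} (hQ : volume Q ≠ ⊤)
    (hf : Integrable f) (hf2 : Integrable fun x => f x ^ 2) :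
    ∫⁻ x in Q, ∫⁻ y in Q, ENNReal.ofReal ((f x - f y) ^ 2) =
      ENNReal.ofReal (2 * volume.real Q * (∫ x in Q, f x ^ 2) - 2 * (∫ x in Q, f x) ^ 2) := by
  have : IsFiniteMeasure (volume.restrict Q) := ⟨by simpa using hQ.lt_top⟩
  have i1 : Integrable f (volume.restrict Q) := hf.integrableOn
  have i2 : Integrable (fun x => f x ^ 2) (volume.restrict Q) := hf2.integrableOn
  set V := volume.real Q with hV
  set m := ∫ x in Q, f x with hm
  set s := ∫ x in Q, f x ^ 2 with hs
  have e : ∀ x y, (f x - f y) ^ 2 = f x ^ 2 - 2 * f x * f y + f y ^ 2 := fun x y => by ring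
  have j1 : ∀ x, Integrable (fun y => f x ^ 2 - 2 * f x * f y) (volume.restrict Q) := fun x =>
    (integrable_const _).sub (i1.const_mul _)
  have hint : ∀ x, ∫ y in Q, (f x - f y) ^ 2 = V * f x ^ 2 - 2 * m * f x + s := fun x => by
    simp_rw [e]
    rw [integral_add (j1 x) i2, integral_sub (integrable_const _) (i1.const_mul _), integral_const,
      integral_const_mul, ← hm, ← hs, measureReal_restrict_apply_univ, ← hV, smul_eq_mul]
    ring
  have hin : ∀ x, ∫⁻ y in Q, ENNReal.ofReal ((f x - f y) ^ 2) =
      ENNReal.ofReal (V * f x ^ 2 - 2 * m * f x + s) := fun x => by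
    rw [← hint, ofReal_integral_eq_lintegral_ofReal (by simp_rw [e]; exact (j1 x).add i2)
      (ae_of_all _ fun y => sq_nonneg _)]
  have hpos : ∀ x, 0 ≤ V * f x ^ 2 - 2 * m * f x + s := fun x => by
    rw [← hint]; exact integral_nonneg fun y => sq_nonneg _
  have j0 : Integrable (fun x => V * f x ^ 2 - 2 * m * f x) (volume.restrict Q) :=
    (i2.const_mul V).sub (i1.const_mul _)
  have j2 : Integrable (fun x => V * f x ^ 2 - 2 * m * f x + s) (volume.restrict Q) :=
    j0.add (integrable_const s)
  simp_rw [hin]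
  rw [← ofReal_integral_eq_lintegral_ofReal j2 (ae_of_all _ hpos)]
  congr 1
  rw [integral_add j0 (integrable_const s), integral_sub (i2.const_mul V) (i1.const_mul _),
    integral_const, integral_const_mul, integral_const_mul, ← hm, ← hs,
    measureReal_restrict_apply_univ, ← hV, smul_eq_mul]
  ring

/-- The Poincaré inequality on a small convex cell, up to the mean value. -/
lemma setIntegral_sq_le {K : Set Plane} {φ : Plane → ℝ} (hφ : IsTestFunction K φ) {Q : Set Plane}
    (hQ : Convex ℝ Q) (hQm : MeasurableSet Q) (hQv : volume Q ≠ ⊤) {d : ℝ} (hd0 : 0 ≤ d)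
    (hd : ∀ x ∈ Q, ∀ y ∈ Q, ‖x - y‖ ^ 2 ≤ d) :
    ∫ x in Q, φ x ^ 2 ≤ (volume.real Q)⁻¹ * (∫ x in Q, φ x) ^ 2 +
      2 * d * ∫ x in Q, ‖gradient φ x‖ ^ 2 := by
  have hg0 : 0 ≤ ∫ x in Q, ‖gradient φ x‖ ^ 2 := integral_nonneg fun x => by positivity
  have h := lintegral_lintegral_sq_sub_le hφ.1 hQ hQm hd
  have h4 : (4 : ℝ≥0∞) = ENNReal.ofReal 4 := by simp
  rw [lintegral_lintegral_sq_sub hQv hφ.integrable hφ.integrable_sq, lintegral_energyDensity hφ,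
    ← ofReal_measureReal hQv, h4, ← ENNReal.ofReal_mul (by norm_num),
    ← ENNReal.ofReal_mul (by positivity), ← ENNReal.ofReal_mul hd0,
    ENNReal.ofReal_le_ofReal_iff (by positivity)] at h
  rcases (measureReal_nonneg (μ := volume) (s := Q)).eq_or_lt with hV | hV
  · have hz : volume.restrict Q = 0 := by
      rw [Measure.restrict_eq_zero]
      exact (measureReal_eq_zero_iff hQv).1 hV.symm
    simp [hz]
  · set V := volume.real Q
    have h' : V * ∫ x in Q, φ x ^ 2 ≤
        V * (V⁻¹ * (∫ x in Q, φ x) ^ 2 + 2 * d * ∫ x in Q, ‖gradient φ x‖ ^ 2) := by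
      rw [mul_add, ← mul_assoc V V⁻¹, mul_inv_cancel₀ hV.ne', one_mul]
      linarith
    exact le_of_mul_le_mul_left h' hV

/-- The cells of the square grid of mesh `δ`. -/
def gridCell (δ : ℝ) (i : ℤ × ℤ) : Set Plane := {x | ⌊x 0 / δ⌋ = i.1 ∧ ⌊x 1 / δ⌋ = i.2}

lemma gridCell_eq (δ : ℝ) (i : ℤ × ℤ) : gridCell δ i =
    (({x : Plane | (i.1 : ℝ) ≤ x 0 / δ} ∩ {x : Plane | x 0 / δ < i.1 + 1}) ∩
      ({x : Plane | (i.2 : ℝ) ≤ x 1 / δ} ∩ {x : Plane | x 1 / δ < i.2 + 1})) := by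
  ext x
  simp only [gridCell, Int.floor_eq_iff, mem_ofPred_eq, mem_inter_iff]

lemma convex_gridCell (δ : ℝ) (i : ℤ × ℤ) : Convex ℝ (gridCell δ i) := by
  have hl : ∀ k : Fin 2, IsLinearMap ℝ fun x : Plane => x k / δ := fun k =>
    ⟨fun x y => by simp [add_div], fun c x => by simp [mul_div_assoc]⟩
  rw [gridCell_eq]
  exact ((convex_halfSpace_ge (hl 0) _).inter (convex_halfSpace_lt (hl 0) _)).inter
    ((convex_halfSpace_ge (hl 1) _).inter (convex_halfSpace_lt (hl 1) _))

lemma measurableSet_gridCell (δ : ℝ) (i : ℤ × ℤ) : MeasurableSet (gridCell δ i) := by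
  have hm : ∀ k : Fin 2, Measurable fun x : Plane => x k / δ := fun k =>
    (show Continuous fun x : Plane => x k / δ by fun_prop).measurable
  rw [gridCell_eq]
  exact ((measurableSet_le measurable_const (hm 0)).inter
    (measurableSet_lt (hm 0) measurable_const)).inter
    ((measurableSet_le measurable_const (hm 1)).inter (measurableSet_lt (hm 1) measurable_const))

lemma norm_sub_sq_le_of_mem_gridCell {δ : ℝ} (hδ : 0 < δ) {i : ℤ × ℤ} {x y : Plane}
    (hx : x ∈ gridCell δ i) (hy : y ∈ gridCell δ i) : ‖x - y‖ ^ 2 ≤ 2 * δ ^ 2 := by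
  have key : ∀ a b : ℝ, ⌊a / δ⌋ = ⌊b / δ⌋ → (a - b) ^ 2 ≤ δ ^ 2 := fun a b h => by
    have := Int.abs_sub_lt_one_of_floor_eq_floor h
    rw [← sub_div, abs_div, abs_of_pos hδ, div_lt_one hδ] at this
    rw [← sq_abs (a - b)]
    exact pow_le_pow_left₀ (abs_nonneg _) this.le 2
  rw [EuclideanSpace.norm_sq_eq, Fin.sum_univ_two]
  have h0 := key (x 0) (y 0) (hx.1.trans hy.1.symm)
  have h1 := key (x 1) (y 1) (hx.2.trans hy.2.symm)
  simp only [PiLp.sub_apply, Real.norm_eq_abs, sq_abs]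
  linarith

lemma volume_gridCell_ne_top {δ : ℝ} (hδ : 0 < δ) (i : ℤ × ℤ) : volume (gridCell δ i) ≠ ⊤ := by
  refine (Bornology.IsBounded.measure_lt_top (Metric.isBounded_iff.2 ⟨2 * δ, ?_⟩)).ne
  intro x hx y hy
  have := norm_sub_sq_le_of_mem_gridCell hδ hx hy
  rw [dist_eq_norm]
  nlinarith [norm_nonneg (x - y)]

lemma pairwise_disjoint_gridCell (δ : ℝ) : Pairwise (Function.onFun Disjoint (gridCell δ)) :=
  fun _ _ hij => Set.disjoint_left.2 fun _ hx hy =>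
    hij (Prod.ext (hx.1.symm.trans hy.1) (hx.2.symm.trans hy.2))

lemma exists_finset_gridCell_cover {δ : ℝ} (hδ : 0 < δ) {K : Set Plane}
    (hK : Bornology.IsBounded K) : ∃ I : Finset (ℤ × ℤ), K ⊆ ⋃ i ∈ I, gridCell δ i := by
  obtain ⟨ρ, hρ0, hρ⟩ := hK.exists_pos_norm_le
  set M := ⌈ρ / δ⌉ with hM
  have hk : ∀ x ∈ K, ∀ k : Fin 2, ⌊x k / δ⌋ ∈ Finset.Icc (-M) M := fun x hx k => by
    have h1 : |x k| ≤ ρ := (PiLp.norm_apply_le x k).trans (hρ x hx)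
    obtain ⟨h2, h3⟩ := abs_le.1 h1
    have h4 := Int.le_ceil (ρ / δ)
    have h5 : x k / δ ≤ ρ / δ := by gcongr
    have h6 : -(ρ / δ) ≤ x k / δ := by rw [← neg_div]; gcongr
    rw [Finset.mem_Icc, Int.le_floor]
    refine ⟨by push_cast; linarith, ?_⟩
    exact Int.cast_le.1 ((Int.floor_le (x k / δ)).trans (h5.trans h4))
  refine ⟨Finset.Icc (-M) M ×ˢ Finset.Icc (-M) M, fun x hx => ?_⟩
  rw [mem_iUnion₂]
  exact ⟨(⌊x 0 / δ⌋, ⌊x 1 / δ⌋), Finset.mem_product.2 ⟨hk x hx 0, hk x hx 1⟩, rfl, rfl⟩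

/-- Up to a small multiple of the energy, the `L²` norm of a test function is controlled by finitely
many of its integrals. -/
lemma exists_cells_integral_sq_le {K : Set Plane} (hK : Bornology.IsBounded K) {ε : ℝ}
    (hε : 0 < ε) : ∃ (I : Finset (ℤ × ℤ)) (Q : ℤ × ℤ → Set Plane),
      (∀ i, MeasurableSet (Q i)) ∧ (∀ i, volume (Q i) ≠ ⊤) ∧ ∀ φ, IsTestFunction K φ →
        ∫ x, φ x ^ 2 ≤ (∑ i ∈ I, (volume.real (Q i))⁻¹ * (∫ x in Q i, φ x) ^ 2) +
          ε * ∫ x, ‖gradient φ x‖ ^ 2 := by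
  -- A cell has squared diameter at most `2 * δ ^ 2`, and the cell inequality doubles this, giving
  -- `4 * δ ^ 2 = ε`.
  set δ := Real.sqrt (ε / 4) with hδdef
  have hδ : 0 < δ := Real.sqrt_pos.2 (by positivity)
  have hδ2 : δ ^ 2 = ε / 4 := Real.sq_sqrt (by positivity)
  obtain ⟨I, hI⟩ := exists_finset_gridCell_cover hδ hK
  refine ⟨I, gridCell δ, measurableSet_gridCell δ, volume_gridCell_ne_top hδ, fun φ hφ => ?_⟩
  have hU : ∫ x, φ x ^ 2 = ∑ i ∈ I, ∫ x in gridCell δ i, φ x ^ 2 := by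
    rw [← integral_biUnion_finset I (fun i _ => measurableSet_gridCell δ i)
      (fun i _ j _ hij => pairwise_disjoint_gridCell δ hij)
      (fun i _ => hφ.integrable_sq.integrableOn)]
    refine (setIntegral_eq_integral_of_forall_compl_eq_zero fun x hx => ?_).symm
    rw [hφ.eq_zero_of_notMem fun h => hx (hI h)]; norm_num
  have hG : ∑ i ∈ I, ∫ x in gridCell δ i, ‖gradient φ x‖ ^ 2 ≤ ∫ x, ‖gradient φ x‖ ^ 2 := by
    rw [← integral_biUnion_finset I (fun i _ => measurableSet_gridCell δ i)
      (fun i _ j _ hij => pairwise_disjoint_gridCell δ hij)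
      (fun i _ => hφ.integrable_norm_gradient_sq.integrableOn)]
    exact setIntegral_le_integral hφ.integrable_norm_gradient_sq
      (ae_of_all _ fun x => by positivity)
  rw [hU]
  calc ∑ i ∈ I, ∫ x in gridCell δ i, φ x ^ 2
      ≤ ∑ i ∈ I, ((volume.real (gridCell δ i))⁻¹ * (∫ x in gridCell δ i, φ x) ^ 2 +
          2 * (2 * δ ^ 2) * ∫ x in gridCell δ i, ‖gradient φ x‖ ^ 2) :=
        Finset.sum_le_sum fun i _ => setIntegral_sq_le hφ (convex_gridCell δ i)
          (measurableSet_gridCell δ i) (volume_gridCell_ne_top hδ i) (by positivity)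
          fun x hx y hy => norm_sub_sq_le_of_mem_gridCell hδ hx hy
    _ = (∑ i ∈ I, (volume.real (gridCell δ i))⁻¹ * (∫ x in gridCell δ i, φ x) ^ 2) +
          ε * ∑ i ∈ I, ∫ x in gridCell δ i, ‖gradient φ x‖ ^ 2 := by
        rw [Finset.sum_add_distrib, ← Finset.mul_sum, hδ2]; ring
    _ ≤ _ := by gcongr

/-! ### A variational principle for compact operators -/

section Abstract

variable {V W : Type*} [NormedAddCommGroup V] [InnerProductSpace ℝ V]
  [NormedAddCommGroup W] [InnerProductSpace ℝ W]

/-- A net for the image of the ball under the finite-rank map `L` lifts to a net for its image under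
`J`. -/
lemma totallyBounded_image_closedBall (J : V →L[ℝ] W)
    (h : ∀ ε : ℝ, 0 < ε → ∃ (ι : Type) (_ : Fintype ι) (L : V →L[ℝ] EuclideanSpace ℝ ι),
      ∀ x, ‖J x‖ ^ 2 ≤ ‖L x‖ ^ 2 + ε * ‖x‖ ^ 2) :
    TotallyBounded (J '' Metric.closedBall 0 1) := by
  rw [Metric.totallyBounded_iff]
  intro ε hε
  -- Points of the unit ball are at distance at most 2, so the error is at most `ε² / 2`; with `(ε /
  -- 2)²` from the net the total stays below `ε²`.
  obtain ⟨ι, _, L, hL⟩ := h (ε ^ 2 / 8) (by positivity)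
  have hb : TotallyBounded (L '' Metric.closedBall 0 1) := by
    have := L.lipschitz.isBounded_image (Metric.isBounded_closedBall (x := 0) (r := 1))
    exact this.isCompact_closure.totallyBounded.subset subset_closure
  obtain ⟨t, hts, htf, htc⟩ := Metric.finite_approx_of_totallyBounded hb (ε / 2) (by positivity)
  have hts' : ∀ y, y ∈ t → ∃ c ∈ Metric.closedBall (0 : V) 1, L c = y := fun y hy => hts hy
  choose! c hc1 hc2 using hts'
  refine ⟨(fun y => J (c y)) '' t, htf.image _, ?_⟩
  rintro _ ⟨x, hx, rfl⟩
  obtain ⟨y, hy, hxy⟩ := mem_iUnion₂.1 (htc ⟨x, hx, rfl⟩)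
  refine mem_iUnion₂.2 ⟨_, ⟨y, hy, rfl⟩, ?_⟩
  rw [mem_ball_iff_norm, ← map_sub]
  rw [mem_ball_iff_norm, ← hc2 y hy, ← map_sub] at hxy
  have h1 := hL (x - c y)
  have h2 : ‖x - c y‖ ≤ 2 := by
    have := norm_sub_le x (c y)
    have hx' := mem_closedBall_zero_iff.1 hx
    have hc' := mem_closedBall_zero_iff.1 (hc1 y hy)
    linarith
  have h3 : ‖x - c y‖ ^ 2 ≤ 4 := by nlinarith [norm_nonneg (x - c y)]
  have h4 : ‖L (x - c y)‖ ^ 2 < (ε / 2) ^ 2 := pow_lt_pow_left₀ hxy (norm_nonneg _) two_ne_zero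
  refine lt_of_pow_lt_pow_left₀ 2 hε.le ?_
  nlinarith [sq_nonneg ε]

/-- For a sequence `x k` in the unit ball maximizing `‖J x‖`, the vectors `J* J x k - τ x k` tend to
0 with `τ = ‖J‖²`. Compactness makes `J x k` converge along a subsequence, hence `x k` as well; the
limit is a top eigenvector of `J* J`. -/
lemma exists_maximizer_of_totallyBounded [CompleteSpace V] [CompleteSpace W] (J : V →L[ℝ] W)
    (hJ : J ≠ 0) (h : TotallyBounded (J '' Metric.closedBall 0 1)) :
    ∃ (x : V) (τ : ℝ), 0 < τ ∧ J x ≠ 0 ∧ (∀ y, inner ℝ (J x) (J y) = τ * inner ℝ x y) ∧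
      ∀ y, ‖J y‖ ^ 2 ≤ τ * ‖y‖ ^ 2 := by
  have hJn : 0 < ‖J‖ := norm_pos_iff.2 hJ
  set τ := ‖J‖ ^ 2 with hτ
  have hτ0 : 0 < τ := by positivity
  have hle : ∀ y, ‖J y‖ ^ 2 ≤ τ * ‖y‖ ^ 2 := fun y => by
    rw [hτ, ← mul_pow]
    exact pow_le_pow_left₀ (norm_nonneg _) (J.le_opNorm y) 2
  have hseq : ∀ k : ℕ, ∃ x : V, ‖x‖ ≤ 1 ∧ ‖J‖ - 1 / ((k : ℝ) + 1) < ‖J x‖ := fun k => by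
    have hpos : (0 : ℝ) < 1 / ((k : ℝ) + 1) := by positivity
    obtain ⟨x, hx, hx'⟩ := J.exists_lt_apply_of_lt_opNorm
      (show ‖J‖ - 1 / ((k : ℝ) + 1) < ‖J‖ by linarith)
    exact ⟨x, hx.le, hx'⟩
  choose x hx1 hx2 using hseq
  have hnorm : Tendsto (fun k => ‖J (x k)‖) atTop (𝓝 ‖J‖) := by
    refine tendsto_of_tendsto_of_tendsto_of_le_of_le (g := fun k : ℕ => ‖J‖ - 1 / ((k : ℝ) + 1))
      (h := fun _ => ‖J‖) ?_ tendsto_const_nhds (fun k => (hx2 k).le) fun k => ?_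
    · simpa using tendsto_const_nhds.sub (tendsto_one_div_add_atTop_nhds_zero_nat (𝕜 := ℝ))
    · exact (J.le_opNorm _).trans (mul_le_of_le_one_right hJn.le (hx1 k))
  have hcomp : IsCompact (closure (J '' Metric.closedBall 0 1)) :=
    isCompact_iff_totallyBounded_isComplete.2 ⟨h.closure, isClosed_closure.isComplete⟩
  obtain ⟨z, -, φ, hφ, hz⟩ := hcomp.tendsto_subseq (x := fun k => J (x k))
    fun k => subset_closure ⟨x k, by simpa using hx1 k, rfl⟩
  set A := ContinuousLinearMap.adjoint J with hA
  have hA1 : ∀ y w, inner ℝ (A w) y = inner ℝ w (J y) := fun y w =>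
    ContinuousLinearMap.adjoint_inner_left J y w
  have hdiff : ∀ k, ‖A (J (x k)) - τ • x k‖ ^ 2 ≤ τ ^ 2 + τ ^ 2 - 2 * τ * ‖J (x k)‖ ^ 2 := fun k => by
    rw [norm_sub_sq_real, inner_smul_right, hA1, real_inner_self_eq_norm_sq, norm_smul,
      Real.norm_of_nonneg hτ0.le, mul_pow]
    have h1 : ‖A (J (x k))‖ ≤ τ := by
      calc ‖A (J (x k))‖ ≤ ‖A‖ * ‖J (x k)‖ := A.le_opNorm _
        _ ≤ ‖J‖ * (‖J‖ * 1) := by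
          rw [hA, LinearIsometryEquiv.norm_map]
          gcongr
          exact (J.le_opNorm _).trans (by gcongr; exact hx1 k)
        _ = τ := by rw [hτ]; ring
    have h2 : ‖A (J (x k))‖ ^ 2 ≤ τ ^ 2 := pow_le_pow_left₀ (norm_nonneg _) h1 2
    have h3 : ‖x k‖ ^ 2 ≤ 1 := pow_le_one₀ (norm_nonneg _) (hx1 k)
    nlinarith [sq_nonneg τ]
  have hlim : Tendsto (fun k => A (J (x k)) - τ • x k) atTop (𝓝 0) := by
    rw [tendsto_zero_iff_norm_tendsto_zero]
    have hsq : Tendsto (fun k => ‖A (J (x k)) - τ • x k‖ ^ 2) atTop (𝓝 0) := by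
      refine squeeze_zero (fun k => by positivity) hdiff ?_
      have := (hnorm.pow 2).const_mul (2 * τ) |>.const_sub (τ ^ 2 + τ ^ 2)
      rwa [← hτ, show τ ^ 2 + τ ^ 2 - 2 * τ * τ = 0 by ring] at this
    have := hsq.sqrt
    simpa using this
  have hxlim : Tendsto (fun k => x (φ k)) atTop (𝓝 (τ⁻¹ • A z)) := by
    have h1 : Tendsto (fun k => A (J (x (φ k)))) atTop (𝓝 (A z)) := (A.continuous.tendsto z).comp hz
    have h2 := (h1.sub (hlim.comp hφ.tendsto_atTop)).const_smul τ⁻¹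
    rw [sub_zero] at h2
    refine h2.congr fun k => ?_
    simp [smul_smul, hτ0.ne']
  set x₀ := τ⁻¹ • A z with hx₀
  have hJx : Tendsto (fun k => J (x (φ k))) atTop (𝓝 (J x₀)) := (J.continuous.tendsto _).comp hxlim
  have hzx : z = J x₀ := tendsto_nhds_unique hz hJx
  refine ⟨x₀, τ, hτ0, ?_, fun y => ?_, hle⟩
  · have := tendsto_nhds_unique hJx.norm (hnorm.comp hφ.tendsto_atTop)
    exact norm_pos_iff.1 (this ▸ hJn)
  · rw [← hzx, ← hA1, hx₀, inner_smul_left, conj_trivial, ← mul_assoc, mul_inv_cancel₀ hτ0.ne',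
      one_mul]

end Abstract

/-! ### The space `H¹₀` as a Hilbert space -/

/-- Pairs of a square integrable function and a square integrable vector field. -/
abbrev FieldPair : Type :=
  WithLp 2 (Lp ℝ 2 (volume : Measure Plane) × Lp Plane 2 (volume : Measure Plane))

lemma IsTestFunction.memLp {K : Set Plane} {φ : Plane → ℝ} (hφ : IsTestFunction K φ) :
    MemLp φ 2 volume := hφ.1.continuous.memLp_of_hasCompactSupport hφ.2.1

lemma IsTestFunction.memLp_gradient {K : Set Plane} {φ : Plane → ℝ} (hφ : IsTestFunction K φ) :
    MemLp (gradient φ) 2 volume :=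
  (continuous_gradient hφ.1).memLp_of_hasCompactSupport hφ.hasCompactSupport_gradient

lemma gradient_add {f g : Plane → ℝ} (hf : ContDiff ℝ ∞ f) (hg : ContDiff ℝ ∞ g) :
    gradient (f + g) = gradient f + gradient g := by
  ext1 x
  simp only [gradient, Pi.add_apply]
  rw [fderiv_add (hf.differentiable (by simp) x) (hg.differentiable (by simp) x), map_add]

lemma gradient_const_smul {f : Plane → ℝ} (hf : ContDiff ℝ ∞ f) (c : ℝ) :
    gradient (c • f) = c • gradient f := by
  ext1 x
  simp only [gradient, Pi.smul_apply]
  rw [fderiv_const_smul (hf.differentiable (by simp) x), map_smul]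

lemma IsTestFunction.add {K : Set Plane} {φ ψ : Plane → ℝ} (hφ : IsTestFunction K φ)
    (hψ : IsTestFunction K ψ) : IsTestFunction K (φ + ψ) :=
  ⟨hφ.1.add hψ.1, hφ.2.1.add hψ.2.1,
    (tsupport_add φ ψ).trans (union_subset hφ.2.2 hψ.2.2)⟩

lemma IsTestFunction.const_smul {K : Set Plane} {φ : Plane → ℝ} (hφ : IsTestFunction K φ) (c : ℝ) :
    IsTestFunction K (c • φ) :=
  ⟨hφ.1.const_smul c, hφ.2.1.smul_left (f := fun _ => c),
    (tsupport_smul_subset_right (fun _ => c) φ).trans hφ.2.2⟩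

lemma isTestFunction_zero (K : Set Plane) : IsTestFunction K 0 :=
  ⟨contDiff_const, HasCompactSupport.zero, by simp⟩

/-- The pair of a test function and its gradient. -/
def IsTestFunction.pair {K : Set Plane} {φ : Plane → ℝ} (hφ : IsTestFunction K φ) : FieldPair :=
  WithLp.toLp 2 (hφ.memLp.toLp φ, hφ.memLp_gradient.toLp (gradient φ))

/-- Test functions with their gradients. -/
def testPairs (K : Set Plane) : Submodule ℝ FieldPair where
  carrier := {p | ∃ φ, ∃ hφ : IsTestFunction K φ, p = hφ.pair}
  add_mem' := by
    rintro _ _ ⟨φ, hφ, rfl⟩ ⟨ψ, hψ, rfl⟩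
    refine ⟨φ + ψ, hφ.add hψ, ?_⟩
    simp only [IsTestFunction.pair, gradient_add hφ.1 hψ.1]
    rfl
  zero_mem' := by
    refine ⟨0, isTestFunction_zero K, ?_⟩
    have : gradient (0 : Plane → ℝ) = 0 := gradient_const' 0
    simp only [IsTestFunction.pair, this]
    rfl
  smul_mem' := by
    rintro c _ ⟨φ, hφ, rfl⟩
    refine ⟨c • φ, hφ.const_smul c, ?_⟩
    simp only [IsTestFunction.pair, gradient_const_smul hφ.1]
    rfl

/-- The space `H¹₀`: the closure of the test functions. -/
def sobolevPairs (K : Set Plane) : Submodule ℝ FieldPair := (testPairs K).topologicalClosure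

lemma IsTestFunction.pair_mem {K : Set Plane} {φ : Plane → ℝ} (hφ : IsTestFunction K φ) :
    hφ.pair ∈ sobolevPairs K := (testPairs K).le_topologicalClosure ⟨φ, hφ, rfl⟩

/-- The density principle that carries inequalities and weak equations from test functions to `H¹₀`.
-/
lemma forall_mem_sobolevPairs {K : Set Plane} {P : FieldPair → Prop} (hP : IsClosed {p | P p})
    (h : ∀ φ, ∀ hφ : IsTestFunction K φ, P hφ.pair) {p : FieldPair} (hp : p ∈ sobolevPairs K) :
    P p := by
  have : closure (testPairs K : Set FieldPair) ⊆ {p | P p} := by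
    refine closure_minimal ?_ hP
    rintro _ ⟨φ, hφ, rfl⟩
    exact h φ hφ
  exact this hp

/-- Convergence in the product Hilbert space is `L²` convergence of both components, so sequential
limits are exactly the closure. -/
lemma isH10_iff {K : Set Plane} {u : Plane → ℝ} {g : Plane → Plane} (hu : MemLp u 2 volume)
    (hg : MemLp g 2 volume) :
    IsH10 K u g ↔ (WithLp.toLp 2 (hu.toLp u, hg.toLp g) : FieldPair) ∈ sobolevPairs K := by
  have hconv : ∀ (φ : ℕ → Plane → ℝ) (hφ : ∀ n, IsTestFunction K (φ n)),
      Tendsto (fun n => (hφ n).pair) atTop (𝓝 (WithLp.toLp 2 (hu.toLp u, hg.toLp g))) ↔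
      Tendsto (fun n => eLpNorm (fun x => φ n x - u x) 2 volume) atTop (𝓝 0) ∧
      Tendsto (fun n => eLpNorm (fun x => gradient (φ n) x - g x) 2 volume) atTop (𝓝 0) := by
    intro φ hφ
    have h1 : Tendsto (fun n => (hφ n).pair) atTop (𝓝 (WithLp.toLp 2 (hu.toLp u, hg.toLp g))) ↔
        Tendsto (fun n => ((hφ n).memLp.toLp (φ n), (hφ n).memLp_gradient.toLp (gradient (φ n))))
          atTop (𝓝 (hu.toLp u, hg.toLp g)) :=
      ((WithLp.homeomorphProd 2 _ _).symm.isInducing.tendsto_nhds_iff (ι := ℕ)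
        (f := fun n => ((hφ n).memLp.toLp (φ n), (hφ n).memLp_gradient.toLp (gradient (φ n))))).symm
    rw [h1, Prod.tendsto_iff, Lp.tendsto_Lp_iff_tendsto_eLpNorm'' _ _ _ hu,
      Lp.tendsto_Lp_iff_tendsto_eLpNorm'' _ _ _ hg]
    rfl
  constructor
  · rintro ⟨-, -, φ, hφ, h1, h2⟩
    refine mem_closure_of_tendsto ((hconv φ hφ).2 ⟨h1, h2⟩) (Eventually.of_forall fun n => ?_)
    exact ⟨φ n, hφ n, rfl⟩
  · intro h
    obtain ⟨p, hp, hlim⟩ := mem_closure_iff_seq_limit.1 h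
    choose φ hφ hpφ using hp
    refine ⟨hu, hg, φ, hφ, (hconv φ hφ).1 ?_⟩
    exact hlim.congr hpφ

lemma isH10_of_mem {K : Set Plane} {p : FieldPair} (hp : p ∈ sobolevPairs K) :
    IsH10 K p.fst p.snd := by
  rw [isH10_iff (Lp.memLp _) (Lp.memLp _), Lp.toLp_coeFn, Lp.toLp_coeFn]
  exact hp

lemma inner_toLp_eq_integral_mul {u v : Plane → ℝ} (hu : MemLp u 2 volume) (hv : MemLp v 2 volume) :
    inner ℝ (hu.toLp u) (hv.toLp v) = ∫ x, u x * v x := by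
  rw [L2.inner_def]
  refine integral_congr_ae ?_
  filter_upwards [hu.coeFn_toLp, hv.coeFn_toLp] with x h1 h2
  rw [h1, h2]; simp [mul_comm]

lemma inner_toLp_eq_integral_inner {g h : Plane → Plane} (hg : MemLp g 2 volume)
    (hh : MemLp h 2 volume) : inner ℝ (hg.toLp g) (hh.toLp h) = ∫ x, inner ℝ (g x) (h x) := by
  rw [L2.inner_def]
  refine integral_congr_ae ?_
  filter_upwards [hg.coeFn_toLp, hh.coeFn_toLp] with x h1 h2
  rw [h1, h2]

lemma norm_toLp_sq {g : Plane → Plane} (hg : MemLp g 2 volume) :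
    ‖hg.toLp g‖ ^ 2 = ∫ x, ‖g x‖ ^ 2 := by
  rw [← real_inner_self_eq_norm_sq, inner_toLp_eq_integral_inner]
  simp_rw [real_inner_self_eq_norm_sq]

lemma norm_pair_fst_sq {K : Set Plane} {φ : Plane → ℝ} (hφ : IsTestFunction K φ) :
    ‖hφ.pair.fst‖ ^ 2 = ∫ x, φ x ^ 2 := by
  rw [← real_inner_self_eq_norm_sq]
  exact (inner_toLp_eq_integral_mul hφ.memLp hφ.memLp).trans (by simp_rw [pow_two])

lemma norm_pair_snd_sq {K : Set Plane} {φ : Plane → ℝ} (hφ : IsTestFunction K φ) :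
    ‖hφ.pair.snd‖ ^ 2 = ∫ x, ‖gradient φ x‖ ^ 2 := norm_toLp_sq hφ.memLp_gradient

lemma continuous_fst_fieldPair : Continuous fun p : FieldPair => p.fst := WithLp.continuous_fst ..

lemma continuous_snd_fieldPair : Continuous fun p : FieldPair => p.snd := WithLp.continuous_snd ..

lemma exists_poincare_sobolevPairs {K : Set Plane} (hK : IsCompact K) :
    ∃ C : ℝ, 0 < C ∧ ∀ p ∈ sobolevPairs K, ‖p.fst‖ ^ 2 ≤ C * ‖p.snd‖ ^ 2 := by
  have c1 := continuous_fst_fieldPair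
  have c2 := continuous_snd_fieldPair
  obtain ⟨C, hC, h⟩ := exists_poincare hK.isBounded
  refine ⟨C, hC, fun p hp => ?_⟩
  refine forall_mem_sobolevPairs (P := fun p => ‖p.fst‖ ^ 2 ≤ C * ‖p.snd‖ ^ 2)
    (isClosed_le (by fun_prop) (by fun_prop)) (fun φ hφ => ?_) hp
  rw [norm_pair_fst_sq, norm_pair_snd_sq]
  exact h φ hφ

lemma exists_finite_control_sobolevPairs {K : Set Plane} (hK : IsCompact K) {ε : ℝ} (hε : 0 < ε) :
    ∃ (ι : Type) (_ : Fintype ι)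
      (L : Lp ℝ 2 (volume : Measure Plane) →L[ℝ] EuclideanSpace ℝ ι),
      ∀ p ∈ sobolevPairs K, ‖p.fst‖ ^ 2 ≤ ‖L p.fst‖ ^ 2 + ε * ‖p.snd‖ ^ 2 := by
  have c1 := continuous_fst_fieldPair
  have c2 := continuous_snd_fieldPair
  obtain ⟨I, Q, hQm, hQv, h⟩ := exists_cells_integral_sq_le hK.isBounded hε
  -- Cell integrals weighted by `|Q i|^(-1/2)`, so that `‖L φ‖²` is the finite sum in the cell
  -- estimate.
  set L : Lp ℝ 2 (volume : Measure Plane) →L[ℝ] EuclideanSpace ℝ I :=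
    (EuclideanSpace.equiv I ℝ).symm.toContinuousLinearMap.comp
      (ContinuousLinearMap.pi fun i : I => Real.sqrt ((volume.real (Q i))⁻¹) •
        innerSL ℝ (indicatorConstLp 2 (hQm i) (hQv i) (1 : ℝ))) with hL
  refine ⟨I, inferInstance, L, fun p hp => ?_⟩
  refine forall_mem_sobolevPairs (P := fun p => ‖p.fst‖ ^ 2 ≤ ‖L p.fst‖ ^ 2 + ε * ‖p.snd‖ ^ 2)
    (isClosed_le (by fun_prop) (by fun_prop)) (fun φ hφ => ?_) hp
  rw [norm_pair_fst_sq, norm_pair_snd_sq]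
  refine (h φ hφ).trans_eq ?_
  congr 1
  rw [EuclideanSpace.norm_sq_eq, ← Finset.sum_coe_sort I]
  refine Finset.sum_congr rfl fun i _ => ?_
  have e : L hφ.pair.fst i = Real.sqrt ((volume.real (Q i))⁻¹) * ∫ x in Q i, φ x := by
    have h1 : inner ℝ (indicatorConstLp 2 (hQm i) (hQv i) (1 : ℝ)) hφ.pair.fst =
        ∫ x in Q i, φ x := by
      rw [L2.inner_indicatorConstLp_one]
      refine integral_congr_ae (ae_restrict_of_ae ?_)
      exact hφ.memLp.coeFn_toLp
    rw [← h1]; rfl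
  rw [e, Real.norm_eq_abs, sq_abs, mul_pow, Real.sq_sqrt (by positivity)]

/-- Both sides of the weak equation are continuous in the test pair, so an eigenfunction may be
tested against all of `H¹₀`, itself included. -/
lemma isDirichletEigenvalue_iff {K : Set Plane} {μ : ℝ} : IsDirichletEigenvalue K μ ↔
    ∃ p ∈ sobolevPairs K, p.fst ≠ 0 ∧
      ∀ q ∈ sobolevPairs K, inner ℝ p.snd q.snd = μ * inner ℝ p.fst q.fst := by
  have c1 := continuous_fst_fieldPair
  have c2 := continuous_snd_fieldPair
  constructor
  · rintro ⟨u, g, hH, hu0, h⟩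
    refine ⟨_, (isH10_iff hH.1 hH.2.1).1 hH, ?_, fun q hq => ?_⟩
    · intro h0
      exact hu0 ((MemLp.toLp_eq_toLp_iff hH.1 MemLp.zero).1 h0)
    · refine forall_mem_sobolevPairs (P := fun q => inner ℝ (hH.2.1.toLp g) q.snd =
        μ * inner ℝ (hH.1.toLp u) q.fst) (isClosed_eq (by fun_prop) (by fun_prop))
        (fun φ hφ => ?_) hq
      have h1 := inner_toLp_eq_integral_inner hH.2.1 hφ.memLp_gradient
      have h2 := inner_toLp_eq_integral_mul hH.1 hφ.memLp
      exact h1.trans ((h φ hφ).trans (by rw [← h2]; rfl))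
  · rintro ⟨p, hp, hp0, h⟩
    refine ⟨p.fst, p.snd, isH10_of_mem hp, fun h0 => hp0 ?_, fun φ hφ => ?_⟩
    · exact (Lp.eq_zero_iff_ae_eq_zero).2 h0
    · have h1 := inner_toLp_eq_integral_inner (Lp.memLp p.snd) hφ.memLp_gradient
      have h2 := inner_toLp_eq_integral_mul (Lp.memLp p.fst) hφ.memLp
      rw [← h1, ← h2, Lp.toLp_coeFn, Lp.toLp_coeFn]
      exact h _ hφ.pair_mem

/-! ### The first eigenpair from the compact embedding of `H¹₀` into `L²`. -/

instance (K : Set Plane) : CompleteSpace (sobolevPairs K) :=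
  (testPairs K).isClosed_topologicalClosure.completeSpace_coe

/-- The embedding of `H¹₀` into `L²`. -/
def sobolevFst (K : Set Plane) : sobolevPairs K →L[ℝ] Lp ℝ 2 (volume : Measure Plane) :=
  (WithLp.fstL 2 ℝ _ _).comp (sobolevPairs K).subtypeL

/-- The weak gradient on `H¹₀`. -/
def sobolevSnd (K : Set Plane) : sobolevPairs K →L[ℝ] Lp Plane 2 (volume : Measure Plane) :=
  (WithLp.sndL 2 ℝ _ _).comp (sobolevPairs K).subtypeL

lemma sobolevFst_apply {K : Set Plane} (x : sobolevPairs K) : sobolevFst K x = x.1.fst := rfl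

lemma sobolev_norm_sq {K : Set Plane} (x : sobolevPairs K) :
    ‖x‖ ^ 2 = ‖x.1.fst‖ ^ 2 + ‖x.1.snd‖ ^ 2 := WithLp.prod_norm_sq_eq_of_L2 x.1

lemma sobolev_inner {K : Set Plane} (x y : sobolevPairs K) :
    inner ℝ x y = inner ℝ x.1.fst y.1.fst + inner ℝ x.1.snd y.1.snd :=
  WithLp.prod_inner_apply x.1 y.1

lemma exists_isTestFunction_integral_pos {K : Set Plane} (hK : (interior K).Nonempty) :
    ∃ φ, IsTestFunction K φ ∧ 0 < ∫ x, φ x ^ 2 := by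
  obtain ⟨x, hx⟩ := hK
  obtain ⟨f, h1, h2, h3, -, h5⟩ :=
    exists_contDiff_tsupport_subset (n := ⊤) (isOpen_interior.mem_nhds hx)
  have hf : IsTestFunction K f := ⟨h3, h2, h1⟩
  refine ⟨f, hf, ?_⟩
  rw [integral_pos_iff_support_of_nonneg (fun x => sq_nonneg _) hf.integrable_sq]
  refine IsOpen.measure_pos _ (h3.continuous.pow 2).isOpen_support ⟨x, ?_⟩
  simp [h5]

/-- The embedding attains its norm at some `u` with `⟨u, v⟩ = τ (⟨u, v⟩ + ⟨∇u, ∇v⟩)`, so `μ = τ⁻¹ -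
1`; maximality is the Rayleigh inequality. Nonempty interior makes the embedding nonzero. -/
lemma exists_firstEigenpair {K : Set Plane} (hK : IsCompact K) (hne : (interior K).Nonempty) :
    ∃ μ : ℝ, IsDirichletEigenvalue K μ ∧
      ∀ φ, IsTestFunction K φ → μ * ∫ x, φ x ^ 2 ≤ ∫ x, ‖gradient φ x‖ ^ 2 := by
  have hJ : sobolevFst K ≠ 0 := by
    intro h0
    obtain ⟨φ, hφ, hpos⟩ := exists_isTestFunction_integral_pos hne
    have : hφ.pair.fst = 0 := congrArg (fun J => J ⟨_, hφ.pair_mem⟩) h0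
    rw [← norm_pair_fst_sq hφ, this, norm_zero] at hpos
    norm_num at hpos
  have htb : TotallyBounded (sobolevFst K '' Metric.closedBall 0 1) := by
    refine totallyBounded_image_closedBall _ fun ε hε => ?_
    obtain ⟨ι, hι, L, hL⟩ := exists_finite_control_sobolevPairs hK hε
    refine ⟨ι, hι, L.comp (sobolevFst K), fun x => (hL x.1 x.2).trans ?_⟩
    refine add_le_add le_rfl (mul_le_mul_of_nonneg_left ?_ hε.le)
    rw [sobolev_norm_sq]
    exact le_add_of_nonneg_left (sq_nonneg _)
  obtain ⟨x, τ, hτ, hx0, hx, hmax⟩ := exists_maximizer_of_totallyBounded _ hJ htb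
  simp only [sobolevFst_apply, sobolev_inner, sobolev_norm_sq] at hx0 hx hmax
  have heig : IsDirichletEigenvalue K (τ⁻¹ - 1) := by
    rw [isDirichletEigenvalue_iff]
    refine ⟨x.1, x.2, hx0, fun q hq => ?_⟩
    have h2 := hx ⟨q, hq⟩
    simp only at h2
    rw [sub_mul, one_mul]
    nth_rw 1 [h2]
    rw [← mul_assoc, inv_mul_cancel₀ hτ.ne']; ring
  refine ⟨τ⁻¹ - 1, heig, fun φ hφ => ?_⟩
  have h1 := hmax ⟨_, hφ.pair_mem⟩
  simp only at h1
  rw [norm_pair_fst_sq, norm_pair_snd_sq] at h1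
  have h2 := mul_le_mul_of_nonneg_left h1 (inv_pos.2 hτ).le
  rw [← mul_assoc, inv_mul_cancel₀ hτ.ne'] at h2
  linarith

lemma le_of_isDirichletEigenvalue {K : Set Plane} {l μ : ℝ} (hμ : IsDirichletEigenvalue K μ)
    (hl : ∀ φ, IsTestFunction K φ → l * ∫ x, φ x ^ 2 ≤ ∫ x, ‖gradient φ x‖ ^ 2) : l ≤ μ := by
  have c1 := continuous_fst_fieldPair
  have c2 := continuous_snd_fieldPair
  obtain ⟨p, hp, hp0, h⟩ := isDirichletEigenvalue_iff.1 hμ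
  have h1 : l * ‖p.fst‖ ^ 2 ≤ ‖p.snd‖ ^ 2 := by
    refine forall_mem_sobolevPairs (P := fun p => l * ‖p.fst‖ ^ 2 ≤ ‖p.snd‖ ^ 2)
      (isClosed_le (by fun_prop) (by fun_prop)) (fun φ hφ => ?_) hp
    rw [norm_pair_fst_sq, norm_pair_snd_sq]
    exact hl φ hφ
  have h2 := h p hp
  rw [real_inner_self_eq_norm_sq, real_inner_self_eq_norm_sq] at h2
  rw [h2] at h1
  exact le_of_mul_le_mul_right h1 (pow_pos (norm_pos_iff.2 hp0) 2)

lemma isLeast_firstEigenvalue {K : Set Plane} (hK : IsCompact K) (hne : (interior K).Nonempty) :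
    IsLeast {μ : ℝ | IsDirichletEigenvalue K μ} (firstEigenvalue K) := by
  obtain ⟨μ, hμ, hR⟩ := exists_firstEigenpair hK hne
  have h : IsLeast {μ : ℝ | IsDirichletEigenvalue K μ} μ :=
    ⟨hμ, fun μ' hμ' => le_of_isDirichletEigenvalue hμ' hR⟩
  rw [firstEigenvalue, h.csInf_eq]
  exact h

/-- The Rayleigh principle. -/
lemma le_firstEigenvalue_iff {K : Set Plane} (hK : IsCompact K) (hne : (interior K).Nonempty)
    {l : ℝ} : l ≤ firstEigenvalue K ↔
      ∀ φ, IsTestFunction K φ → l * ∫ x, φ x ^ 2 ≤ ∫ x, ‖gradient φ x‖ ^ 2 := by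
  refine ⟨fun h φ hφ => ?_, fun h => le_of_isDirichletEigenvalue (isLeast_firstEigenvalue hK hne).1 h⟩
  obtain ⟨μ, hμ, hR⟩ := exists_firstEigenpair hK hne
  refine (mul_le_mul_of_nonneg_right (h.trans ?_) (integral_nonneg fun x => sq_nonneg _)).trans
    (hR φ hφ)
  exact (isLeast_firstEigenvalue hK hne).2 hμ

/-! ### The torsion problem -/

/-- The indicator function of a compact set, as an element of `L²`. -/
def compactIndicator {K : Set Plane} (hK : IsCompact K) : Lp ℝ 2 (volume : Measure Plane) :=
  indicatorConstLp 2 hK.measurableSet hK.measure_lt_top.ne 1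

lemma inner_compactIndicator_pair {K : Set Plane} (hK : IsCompact K) {φ : Plane → ℝ}
    (hφ : IsTestFunction K φ) : inner ℝ (compactIndicator hK) hφ.pair.fst = ∫ x, φ x := by
  rw [compactIndicator, L2.inner_indicatorConstLp_one]
  refine (integral_congr_ae (ae_restrict_of_ae hφ.memLp.coeFn_toLp)).trans ?_
  exact setIntegral_eq_integral_of_forall_compl_eq_zero fun x hx => hφ.eq_zero_of_notMem hx

lemma isTorsionFunction_iff {K : Set Plane} (hK : IsCompact K) {u : Plane → ℝ} {g : Plane → Plane}
    (hu : MemLp u 2 volume) (hg : MemLp g 2 volume) : IsTorsionFunction K u g ↔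
      (WithLp.toLp 2 (hu.toLp u, hg.toLp g) : FieldPair) ∈ sobolevPairs K ∧
      ∀ q ∈ sobolevPairs K, inner ℝ (hg.toLp g) q.snd = inner ℝ (compactIndicator hK) q.fst := by
  have c1 := continuous_fst_fieldPair
  have c2 := continuous_snd_fieldPair
  rw [IsTorsionFunction, isH10_iff hu hg]
  refine and_congr_right fun _ => ⟨fun h q hq => ?_, fun h φ hφ => ?_⟩
  · refine forall_mem_sobolevPairs (P := fun q => inner ℝ (hg.toLp g) q.snd =
      inner ℝ (compactIndicator hK) q.fst) (isClosed_eq (by fun_prop) (by fun_prop))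
      (fun φ hφ => ?_) hq
    rw [inner_compactIndicator_pair, ← h φ hφ]
    exact inner_toLp_eq_integral_inner hg hφ.memLp_gradient
  · rw [← inner_compactIndicator_pair hK hφ, ← h _ hφ.pair_mem]
    exact (inner_toLp_eq_integral_inner hg hφ.memLp_gradient).symm

lemma isTorsionFunction_coeFn {K : Set Plane} (hK : IsCompact K) {p : FieldPair}
    (hp : p ∈ sobolevPairs K)
    (h : ∀ q ∈ sobolevPairs K, inner ℝ p.snd q.snd = inner ℝ (compactIndicator hK) q.fst) :
    IsTorsionFunction K p.fst p.snd := by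
  refine ⟨isH10_of_mem hp, fun φ hφ => ?_⟩
  have h1 := inner_toLp_eq_integral_inner (Lp.memLp p.snd) hφ.memLp_gradient
  rw [← inner_compactIndicator_pair hK hφ, ← h1, Lp.toLp_coeFn]
  exact h _ hφ.pair_mem

/-- The Dirichlet form on `H¹₀`. -/
def dirichletForm (K : Set Plane) : sobolevPairs K →L[ℝ] sobolevPairs K →L[ℝ] ℝ :=
  (innerSL ℝ).bilinearComp (sobolevSnd K) (sobolevSnd K)

lemma dirichletForm_apply {K : Set Plane} (x y : sobolevPairs K) :
    dirichletForm K x y = inner ℝ x.1.snd y.1.snd := rfl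

/-- Poincaré bounds the full `H¹` norm squared by `C + 1` times the energy. -/
lemma isCoercive_dirichletForm {K : Set Plane} (hK : IsCompact K) :
    IsCoercive (dirichletForm K) := by
  obtain ⟨C, hC, h⟩ := exists_poincare_sobolevPairs hK
  refine ⟨(C + 1)⁻¹, by positivity, fun x => ?_⟩
  have h1 : dirichletForm K x x = ‖x.1.snd‖ ^ 2 := by
    rw [dirichletForm_apply, real_inner_self_eq_norm_sq]
  have h2 := h x.1 x.2
  rw [h1, mul_assoc, ← pow_two, sobolev_norm_sq, inv_mul_le_iff₀ (by positivity)]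
  linarith

/-- Lax–Milgram combined with the Riesz representation. -/
lemma IsCoercive.exists_forall_eq {V : Type*} [NormedAddCommGroup V] [InnerProductSpace ℝ V]
    [CompleteSpace V] {B : V →L[ℝ] V →L[ℝ] ℝ} (hB : IsCoercive B) (l : V →L[ℝ] ℝ) :
    ∃ x, ∀ y, B x y = l y := by
  refine ⟨hB.continuousLinearEquivOfBilin.symm ((InnerProductSpace.toDual ℝ V).symm l),
    fun y => ?_⟩
  rw [← hB.continuousLinearEquivOfBilin_apply, ContinuousLinearEquiv.apply_symm_apply,
    InnerProductSpace.toDual_symm_apply]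

/-- Integration over a compact set, as a functional on `H¹₀`. -/
def sobolevIntegral {K : Set Plane} (hK : IsCompact K) : sobolevPairs K →L[ℝ] ℝ :=
  (innerSL ℝ (compactIndicator hK)).comp (sobolevFst K)

lemma exists_torsionPair {K : Set Plane} (hK : IsCompact K) :
    ∃ x : sobolevPairs K, ∀ y, dirichletForm K x y = sobolevIntegral hK y :=
  IsCoercive.exists_forall_eq (isCoercive_dirichletForm hK) (sobolevIntegral hK)

lemma exists_isTorsionFunction {K : Set Plane} (hK : IsCompact K) :
    ∃ (u : Plane → ℝ) (g : Plane → Plane), IsTorsionFunction K u g := by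
  obtain ⟨x, hx⟩ := exists_torsionPair hK
  exact ⟨x.1.fst, x.1.snd, isTorsionFunction_coeFn hK x.2 fun q hq => hx ⟨q, hq⟩⟩

/-- Gradients of test functions vanish off `K`, hence so does their `L²` limit. This reconciles the
rigidity, an integral over `K`, with the weak formulation on the plane. -/
lemma IsH10.integral_norm_sq_eq {K : Set Plane} (hK : IsCompact K) {u : Plane → ℝ}
    {g : Plane → Plane} (h : IsH10 K u g) : ∫ x in K, ‖g x‖ ^ 2 = ∫ x, ‖g x‖ ^ 2 := by
  obtain ⟨-, hg, φ, hφ, -, hlim⟩ := h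
  have h0 : eLpNorm g 2 (volume.restrict Kᶜ) = 0 := by
    refine le_antisymm (ge_of_tendsto' hlim fun n => ?_) zero_le
    calc eLpNorm g 2 (volume.restrict Kᶜ)
        = eLpNorm (fun x => gradient (φ n) x - g x) 2 (volume.restrict Kᶜ) := by
          rw [← eLpNorm_neg]
          refine eLpNorm_congr_ae ?_
          filter_upwards [ae_restrict_mem hK.measurableSet.compl] with x hx
          simp [(hφ n).gradient_eq_zero_of_notMem hx]
      _ ≤ _ := eLpNorm_mono_measure _ Measure.restrict_le_self
  rw [eLpNorm_eq_zero_iff (hg.1.mono_measure Measure.restrict_le_self) two_ne_zero] at h0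
  refine setIntegral_eq_integral_of_ae_compl_eq_zero ?_
  filter_upwards [(ae_restrict_iff' hK.measurableSet.compl).1 h0] with x hx hxK
  simp [hx hxK]

/-- Testing both equations with the difference of the solutions shows that the gradients agree. -/
lemma isTorsionFunction_integral_eq {K : Set Plane} (hK : IsCompact K) {u u' : Plane → ℝ}
    {g g' : Plane → Plane} (h : IsTorsionFunction K u g) (h' : IsTorsionFunction K u' g') :
    ∫ x in K, ‖g x‖ ^ 2 = ∫ x in K, ‖g' x‖ ^ 2 := by
  rw [h.1.integral_norm_sq_eq hK, h'.1.integral_norm_sq_eq hK]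
  obtain ⟨hm, ht⟩ := (isTorsionFunction_iff hK h.1.1 h.1.2.1).1 h
  obtain ⟨hm', ht'⟩ := (isTorsionFunction_iff hK h'.1.1 h'.1.2.1).1 h'
  have hd := (sobolevPairs K).sub_mem hm hm'
  have h0 := (ht _ hd).trans (ht' _ hd).symm
  rw [← sub_eq_zero, ← inner_sub_left] at h0
  have h1 : h.1.2.1.toLp g - h'.1.2.1.toLp g' = 0 := inner_self_eq_zero.1 h0
  rw [← norm_toLp_sq h.1.2.1, ← norm_toLp_sq h'.1.2.1, sub_eq_zero.1 h1]

lemma torsionalRigidity_eq {K : Set Plane} (hK : IsCompact K) {u : Plane → ℝ} {g : Plane → Plane}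
    (h : IsTorsionFunction K u g) : torsionalRigidity K = ∫ x in K, ‖g x‖ ^ 2 := by
  have : {t : ℝ | ∃ (u : Plane → ℝ) (g : Plane → Plane),
      IsTorsionFunction K u g ∧ t = ∫ x in K, ‖g x‖ ^ 2} = {∫ x in K, ‖g x‖ ^ 2} := by
    refine Subset.antisymm ?_ (singleton_subset_iff.2 ⟨u, g, h, rfl⟩)
    rintro _ ⟨u', g', h', rfl⟩
    exact isTorsionFunction_integral_eq hK h' h
  rw [torsionalRigidity, this, csSup_singleton]

/-- The variational characterization of the torsional rigidity. -/
lemma torsionalRigidity_le_iff {K : Set Plane} (hK : IsCompact K) {c : ℝ} :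
    torsionalRigidity K ≤ c ↔
      ∀ φ, IsTestFunction K φ → 2 * (∫ x, φ x) - ∫ x, ‖gradient φ x‖ ^ 2 ≤ c := by
  have c1 := continuous_fst_fieldPair
  have c2 := continuous_snd_fieldPair
  obtain ⟨u, g, h⟩ := exists_isTorsionFunction hK
  obtain ⟨hm, ht⟩ := (isTorsionFunction_iff hK h.1.1 h.1.2.1).1 h
  rw [torsionalRigidity_eq hK h, h.1.integral_norm_sq_eq hK, ← norm_toLp_sq h.1.2.1]
  constructor
  · intro hc φ hφ
    rw [← inner_compactIndicator_pair hK hφ, ← ht _ hφ.pair_mem, ← norm_pair_snd_sq hφ]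
    -- Completing the square: the functional at `φ` equals `‖g‖² - ‖g - ∇φ‖²`.
    have := norm_sub_sq_real (h.1.2.1.toLp g) hφ.pair.snd
    linarith [sq_nonneg ‖h.1.2.1.toLp g - hφ.pair.snd‖]
  · intro hc
    -- By density the bound holds at the torsion function itself, where the functional equals
    -- `‖g‖²`.
    have h1 : 2 * inner ℝ (compactIndicator hK) (h.1.1.toLp u) - ‖h.1.2.1.toLp g‖ ^ 2 ≤ c := by
      refine forall_mem_sobolevPairs (P := fun q => 2 * inner ℝ (compactIndicator hK) q.fst -
        ‖q.snd‖ ^ 2 ≤ c) (isClosed_le (by fun_prop) (by fun_prop)) (fun φ hφ => ?_) hm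
      rw [inner_compactIndicator_pair, norm_pair_snd_sq]
      exact hc φ hφ
    have h2 : inner ℝ (h.1.2.1.toLp g) (h.1.2.1.toLp g) =
      inner ℝ (compactIndicator hK) (h.1.1.toLp u) := ht _ hm
    rw [real_inner_self_eq_norm_sq] at h2
    linarith

/-! ### Monotonicity and scaling of the eigenvalue and of the torsional rigidity -/

lemma IsTestFunction.mono {T K : Set Plane} (h : T ⊆ K) {φ : Plane → ℝ} (hφ : IsTestFunction T φ) :
    IsTestFunction K φ := ⟨hφ.1, hφ.2.1, hφ.2.2.trans (interior_mono h)⟩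

lemma firstEigenvalue_anti {T K : Set Plane} (hT : IsCompact T) (hTi : (interior T).Nonempty)
    (hK : IsCompact K) (h : T ⊆ K) : firstEigenvalue K ≤ firstEigenvalue T :=
  (le_firstEigenvalue_iff hT hTi).2 fun _ hφ =>
    (le_firstEigenvalue_iff hK (hTi.mono (interior_mono h))).1 le_rfl _ (hφ.mono h)

lemma torsionalRigidity_mono {T K : Set Plane} (hT : IsCompact T) (hK : IsCompact K) (h : T ⊆ K) :
    torsionalRigidity T ≤ torsionalRigidity K :=
  (torsionalRigidity_le_iff hT).2 fun _ hφ => (torsionalRigidity_le_iff hK).1 le_rfl _ (hφ.mono h)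

lemma IsTestFunction.comp_smul {K : Set Plane} {c : ℝ} (hc : c ≠ 0) {φ : Plane → ℝ}
    (hφ : IsTestFunction (c • K) φ) : IsTestFunction K fun x => φ (c • x) := by
  refine ⟨hφ.1.comp (contDiff_const_smul c),
    hφ.2.1.comp_homeomorph (Homeomorph.smulOfNeZero c hc), ?_⟩
  intro x hx
  have h1 : c • x ∈ tsupport φ :=
    closure_minimal (t := (c • ·) ⁻¹' tsupport φ) (fun y hy => subset_tsupport φ hy)
      ((isClosed_tsupport φ).preimage (continuous_const_smul c)) hx
  have h2 := hφ.2.2 h1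
  rw [interior_smul₀ hc] at h2
  exact (smul_mem_smul_set_iff₀ hc _ _).1 h2

lemma gradient_comp_smul {φ : Plane → ℝ} (hφ : ContDiff ℝ ∞ φ) (c : ℝ) (x : Plane) :
    gradient (fun x => φ (c • x)) x = c • gradient φ (c • x) := by
  have h1 : HasFDerivAt (fun x : Plane => c • x) (c • ContinuousLinearMap.id ℝ Plane) x :=
    (hasFDerivAt_id x).const_smul c
  have h2 := (hφ.differentiable (by simp) (c • x)).hasFDerivAt.comp x h1
  have h3 : fderiv ℝ (fun x => φ (c • x)) x = c • fderiv ℝ φ (c • x) := by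
    refine h2.fderiv.trans ?_
    ext y; simp
  rw [gradient, h3, map_smul, gradient]

lemma integral_comp_smul_plane {c : ℝ} (f : Plane → ℝ) :
    ∫ x, f (c • x) = (c ^ 2)⁻¹ * ∫ x, f x := by
  rw [Measure.integral_comp_smul]
  simp

/-- In dimension two the factor `c²` from the gradients cancels the Jacobian. -/
lemma integral_norm_gradient_comp_smul {φ : Plane → ℝ} (hφ : ContDiff ℝ ∞ φ) {c : ℝ} (hc : c ≠ 0) :
    ∫ x, ‖gradient (fun x => φ (c • x)) x‖ ^ 2 = ∫ x, ‖gradient φ x‖ ^ 2 := by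
  simp_rw [gradient_comp_smul hφ, norm_smul, mul_pow, Real.norm_eq_abs, sq_abs]
  rw [integral_const_mul, integral_comp_smul_plane (fun x => ‖gradient φ x‖ ^ 2), ← mul_assoc,
    mul_inv_cancel₀ (pow_ne_zero 2 hc), one_mul]

lemma interior_smul_nonempty {K : Set Plane} (hne : (interior K).Nonempty) {c : ℝ} (hc : c ≠ 0) :
    (interior (c • K)).Nonempty := by
  rw [interior_smul₀ hc]; exact hne.smul_set

lemma firstEigenvalue_smul {K : Set Plane} (hK : IsCompact K) (hne : (interior K).Nonempty) {c : ℝ}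
    (hc : 0 < c) : firstEigenvalue (c • K) = (c ^ 2)⁻¹ * firstEigenvalue K := by
  -- One inequality suffices: the other is its instance for `c⁻¹` and `c • K`.
  have key : ∀ {K : Set Plane}, IsCompact K → (interior K).Nonempty → ∀ {c : ℝ}, 0 < c →
      (c ^ 2)⁻¹ * firstEigenvalue K ≤ firstEigenvalue (c • K) := by
    intro K hK hne c hc
    refine (le_firstEigenvalue_iff (hK.smul c) (interior_smul_nonempty hne hc.ne')).2 fun φ hφ => ?_
    have h := (le_firstEigenvalue_iff hK hne).1 le_rfl _ (hφ.comp_smul hc.ne')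
    rw [integral_norm_gradient_comp_smul hφ.1 hc.ne',
      integral_comp_smul_plane fun x => φ x ^ 2] at h
    linarith
  refine le_antisymm ?_ (key hK hne hc)
  have h := key (hK.smul c) (interior_smul_nonempty hne hc.ne') (inv_pos.2 hc)
  rw [inv_smul_smul₀ hc.ne', inv_pow, inv_inv] at h
  rwa [le_inv_mul_iff₀ (by positivity)]

lemma torsionalRigidity_smul {K : Set Plane} (hK : IsCompact K) {c : ℝ} (hc : 0 < c) :
    torsionalRigidity (c • K) = c ^ 4 * torsionalRigidity K := by
  have key : ∀ {K : Set Plane}, IsCompact K → ∀ {c : ℝ}, 0 < c →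
      torsionalRigidity (c • K) ≤ c ^ 4 * torsionalRigidity K := by
    intro K hK c hc
    refine (torsionalRigidity_le_iff (hK.smul c)).2 fun φ hφ => ?_
    have hψ := hφ.comp_smul hc.ne'
    -- The amplitude `c⁻²` matches the scaling of solutions of `-Δu = 1`, making both terms of the
    -- functional scale by `c⁻⁴`.
    have h := (torsionalRigidity_le_iff hK).1 le_rfl _ (hψ.const_smul (c ^ 2)⁻¹)
    rw [gradient_const_smul hψ.1] at h
    simp only [Pi.smul_apply, smul_eq_mul, norm_smul, mul_pow, Real.norm_eq_abs, sq_abs] at h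
    rw [integral_const_mul, integral_const_mul, integral_norm_gradient_comp_smul hφ.1 hc.ne',
      integral_comp_smul_plane φ] at h
    have h2 := mul_le_mul_of_nonneg_left h (show 0 ≤ c ^ 4 by positivity)
    refine le_trans (le_of_eq ?_) h2
    field_simp
  refine le_antisymm (key hK hc) ?_
  have h := key (hK.smul c) (inv_pos.2 hc)
  rw [inv_smul_smul₀ hc.ne', inv_pow] at h
  rwa [← le_inv_mul_iff₀ (by positivity)]

/-! ### Transfer of bounds from three-caps to all shapes. -/

lemma interior_nonempty_of_mem_shapesOfWidthAtLeast {K : Set Plane}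
    (hK : K ∈ shapesOfWidthAtLeast 1) : (interior K).Nonempty := by
  obtain ⟨r, T, hT, hTK⟩ := exists_isThreeCap_subset hK
  exact hT.interior_nonempty.mono (interior_mono hTK)

lemma inv_smul_mem_shapesOfWidthAtLeast_one {w : ℝ} (hw : 0 < w) {K : Set Plane}
    (hK : K ∈ shapesOfWidthAtLeast w) : w⁻¹ • K ∈ shapesOfWidthAtLeast 1 := by
  have := smul_mem_shapesOfWidthAtLeast (inv_pos.2 hw) hK
  rwa [inv_mul_cancel₀ hw.ne'] at this

lemma cheeger_le_of_threeCaps {c : ℝ≥0∞}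
    (h : ∀ (r : ℝ) (T : Set Plane), IsThreeCap r T → cheeger T ≤ c) {K : Set Plane}
    (hK : K ∈ shapesOfWidthAtLeast 1) : cheeger K ≤ c := by
  obtain ⟨r, T, hT, hTK⟩ := exists_isThreeCap_subset hK
  exact (cheeger_mono hTK).trans (h r T hT)

lemma firstEigenvalue_le_of_threeCaps {c : ℝ}
    (h : ∀ (r : ℝ) (T : Set Plane), IsThreeCap r T → firstEigenvalue T ≤ c) {K : Set Plane}
    (hK : K ∈ shapesOfWidthAtLeast 1) : firstEigenvalue K ≤ c := by
  obtain ⟨r, T, hT, hTK⟩ := exists_isThreeCap_subset hK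
  exact (firstEigenvalue_anti hT.isCompact hT.interior_nonempty hK.2.1 hTK).trans (h r T hT)

lemma le_torsionalRigidity_of_threeCaps {c : ℝ}
    (h : ∀ (r : ℝ) (T : Set Plane), IsThreeCap r T → c ≤ torsionalRigidity T) {K : Set Plane}
    (hK : K ∈ shapesOfWidthAtLeast 1) : c ≤ torsionalRigidity K := by
  obtain ⟨r, T, hT, hTK⟩ := exists_isThreeCap_subset hK
  exact (h r T hT).trans (torsionalRigidity_mono hT.isCompact hK.2.1 hTK)

end

theorem mainTheorem9 :
    -- the first eigenvalue and the torsional rigidity are well defined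
    (∀ K : Set Plane, Convex ℝ K → IsCompact K → (interior K).Nonempty →
      IsLeast {μ : ℝ | IsDirichletEigenvalue K μ} (firstEigenvalue K) ∧
      (∃ (u : Plane → ℝ) (g : Plane → Plane), IsTorsionFunction K u g) ∧
      (∀ (u : Plane → ℝ) (g : Plane → Plane), IsTorsionFunction K u g →
        torsionalRigidity K = ∫ x in K, ‖g x‖ ^ 2)) ∧
    -- existence of three-cap subsets
    (∀ K ∈ shapesOfMinimalWidth 1, inradius K ∈ Icc (1 / 3 : ℝ) (1 / 2) ∧
      ∃ T : Set Plane, IsThreeCap (inradius K) T ∧ T ⊆ K) ∧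
    (∀ K ∈ shapesOfWidthAtLeast 1, ∃ (r : ℝ) (T : Set Plane), IsThreeCap r T ∧ T ⊆ K) ∧
    -- bounds on three-caps transfer to all shapes
    (∀ c : ℝ≥0∞, (∀ (r : ℝ) (T : Set Plane), IsThreeCap r T → cheeger T ≤ c) →
      ∀ K ∈ shapesOfWidthAtLeast 1, cheeger K ≤ c) ∧
    (∀ c : ℝ, (∀ (r : ℝ) (T : Set Plane), IsThreeCap r T → firstEigenvalue T ≤ c) →
      ∀ K ∈ shapesOfWidthAtLeast 1, firstEigenvalue K ≤ c) ∧
    (∀ c : ℝ, (∀ (r : ℝ) (T : Set Plane), IsThreeCap r T → c ≤ torsionalRigidity T) →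
      ∀ K ∈ shapesOfWidthAtLeast 1, c ≤ torsionalRigidity K) ∧
    -- optimality of the equilateral triangle
    (∀ Te : Set Plane, IsEquilateralTriangle 1 Te →
      (∀ w : ℝ, 0 < w → w • Te ∈ shapesOfMinimalWidth w ∧ w • Te ∈ shapesOfWidthAtLeast w) ∧
      ((∀ (r : ℝ) (T : Set Plane), IsThreeCap r T → cheeger T ≤ cheeger Te) →
        ∀ w : ℝ, 0 < w → IsMaxOn cheeger (shapesOfWidthAtLeast w) (w • Te)) ∧
      ((∀ (r : ℝ) (T : Set Plane), IsThreeCap r T → firstEigenvalue T ≤ firstEigenvalue Te) →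
        ∀ w : ℝ, 0 < w → IsMaxOn firstEigenvalue (shapesOfWidthAtLeast w) (w • Te)) ∧
      ((∀ (r : ℝ) (T : Set Plane), IsThreeCap r T →
          torsionalRigidity Te ≤ torsionalRigidity T) →
        ∀ w : ℝ, 0 < w → IsMinOn torsionalRigidity (shapesOfWidthAtLeast w) (w • Te))) := by
  refine ⟨fun K _ hK hne => ⟨isLeast_firstEigenvalue hK hne, exists_isTorsionFunction hK,
      fun u g h => torsionalRigidity_eq hK h⟩,
    fun K hK => inradius_mem_and_exists_isThreeCap hK, fun K hK => exists_isThreeCap_subset hK,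
    fun c h K hK => cheeger_le_of_threeCaps h hK,
    fun c h K hK => firstEigenvalue_le_of_threeCaps h hK,
    fun c h K hK => le_torsionalRigidity_of_threeCaps h hK, fun Te hTe => ?_⟩
  have hTe1 := hTe.mem_shapesOfMinimalWidth
  have hTeC : IsCompact Te := hTe1.2.1
  have hTei := interior_nonempty_of_mem_shapesOfWidthAtLeast (shapesOfMinimalWidth_subset 1 hTe1)
  have hTew : ∀ w : ℝ, 0 < w → w • Te ∈ shapesOfMinimalWidth w := fun w hw => by
    simpa using smul_mem_shapesOfMinimalWidth hw hTe1
  refine ⟨fun w hw => ⟨hTew w hw, shapesOfMinimalWidth_subset w (hTew w hw)⟩,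
    fun h w hw K hK => ?_, fun h w hw K hK => ?_, fun h w hw K hK => ?_⟩
  · have h1 := cheeger_le_of_threeCaps h (inv_smul_mem_shapesOfWidthAtLeast_one hw hK)
    have h2 := cheeger_smul_le hw (w⁻¹ • K)
    -- Scaling back by `w⁻¹` supplies the reverse comparison between `Te` and `w • Te`.
    have h3 := cheeger_smul_le (inv_pos.2 hw) (w • Te)
    rw [smul_inv_smul₀ hw.ne'] at h2
    rw [inv_smul_smul₀ hw.ne', ENNReal.ofReal_inv_of_pos hw, inv_inv] at h3
    have hw0 : ENNReal.ofReal w ≠ 0 := by simpa using hw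
    calc cheeger K ≤ (ENNReal.ofReal w)⁻¹ * cheeger (w⁻¹ • K) := h2
      _ ≤ (ENNReal.ofReal w)⁻¹ * (ENNReal.ofReal w * cheeger (w • Te)) := by
        gcongr
        exact h1.trans h3
      _ = cheeger (w • Te) := by
        rw [← mul_assoc, ENNReal.inv_mul_cancel hw0 ENNReal.ofReal_ne_top, one_mul]
  · have hK1 := inv_smul_mem_shapesOfWidthAtLeast_one hw hK
    have h1 := firstEigenvalue_le_of_threeCaps h hK1
    have h2 := firstEigenvalue_smul hK1.2.1 (interior_nonempty_of_mem_shapesOfWidthAtLeast hK1) hw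
    rw [smul_inv_smul₀ hw.ne'] at h2
    simp only [mem_ofPred_eq]
    rw [h2, firstEigenvalue_smul hTeC hTei hw]
    gcongr
  · have hK1 := inv_smul_mem_shapesOfWidthAtLeast_one hw hK
    have h1 := le_torsionalRigidity_of_threeCaps h hK1
    have h2 := torsionalRigidity_smul hK1.2.1 hw
    rw [smul_inv_smul₀ hw.ne'] at h2
    simp only [mem_ofPred_eq]
    rw [h2, torsionalRigidity_smul hTeC hw]
    gcongr
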